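/- Let $x_{i,t}=\lambda_i'f_t+e_{i,t}$, $i\ge 1$, $t\ge 1$, with random factors $f_t\in\mathbb R^r$ ($r\ge1$ fixed), random loadings $\lambda_i=\lambda_{i}^{(N)}\in\mathbb R^r$ (which may depend on the panel size $N$) and random idiosyncratic components $e_{i,t}$. Write $F_t=(f_1,\dots,f_t)'$, $\Lambda=(\lambda_1,\dots,\lambda_N)'$, and let $E_t$ and $X_t=F_t\Lambda'+E_t$ be the $t\times N$ matrices of the $e_{i,s}$ and the $x_{i,s}$, $i\le N$, $s\le t$. For every $N$ and $t\ge r$ let $\widehat F_t=(\widehat f_1,\dots,\widehat f_t)'$ be $\sqrt t$ times a $t\times r$ matrix of orthonormal eigenvectors for the $r$ largest eigenvalues (in decreasing order) of $(Nt)^{-1}X_tX_t'$, let $D_{Nt,r}^2$ be the diagonal matrix of these eigenvalues, and $H_{Nt,r}=D_{Nt,r}^{-2}(t^{-1}\widehat F_t'F_t)(N^{-1}\Lambda'\Lambda)$; $\widehat f_t$ denotes the last row of $\widehat F_t$. Matrix norms are Frobenius norms. Let $k_0=\lfloor T\pi_0\rfloor$ with $\pi_0\in(0,1)$, and let $(N,T)\to\infty$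 jointly, along any path. Assume, with constants $M$ independent of $i,s,t,N,T$: $\sup_{k_0\le t\le T-1}\|T^{-1}\sum_{s=1}^t(f_sf_s'-I_r)\|=O_p(T^{-1/2})$; $\mathbb E\,e_{i,t}^4\le M$; $\mathbb E[(N^{-1/2}\sum_{i=1}^N(e_{i,t}e_{i,s}-\mathbb E(e_{i,t}e_{i,s})))^4]\le M$; $T^{-1}\sum_{t=1}^T\sum_{s=1}^T[\mathbb E(e_{i,t}e_{i,s})]^2\le M$. (a) Homogeneous loadings. Let $\alpha\in(0,1]$ and assume $\|N^{-\alpha}\Lambda'\Lambda-\Sigma_\Lambda\|=O_p(N^{-\alpha/2})$ for some positive definite $\Sigma_\Lambda$, $\mathbb E[(N^{-\alpha/2}\sum_{i=1}^N f_s'\lambda_ie_{i,t})^2]\le M$ and $\mathbb E\|N^{-\alpha/2}\sum_{i=1}^N\lambda_ie_{i,t}\|^8\le M$. Then $D_{Nt,r}^2$ is invertible for all $k_0\le t\le T-1$ with probability tending to one, and (i) for all integer sequences $\lfloor f_1(T)\rfloor,\lfloor f_2(T)\rfloor$ such that eventually $k_0\le\lfloor f_1(T)\rfloor$ and $\lfloor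 f_2(T)\rfloor\le T-1$, and such that $\lfloor f_j(T)\rfloor/T\to q_j$ with $q_1<q_2$, and with $d_T=\lfloor f_2(T)\rfloor-\lfloor f_1(T)\rfloor+1$, $$\frac1{d_T}\sum_{t=\lfloor f_1(T)\rfloor}^{\lfloor f_2(T)\rfloor}\|\widehat f_t-H_{Nt,r}f_t\|^2=O_p\Big(\frac{N^{2-2\alpha}}{T}\Big)+O_p(N^{1-2\alpha});$$ (ii) $$\sup_{k_0\le t\le T-1}\frac1t\|\widehat F_t-F_tH_{Nt,r}'\|^2=\sup_{k_0\le t\le T-1}\frac1t\sum_{s=1}^t\|\widehat f_s-H_{Nt,r}f_s\|^2=O_p\Big(\frac{N^{2-2\alpha}}{k_0}\Big)+O_p(N^{1-2\alpha}),$$ where $\widehat f_s$ is the $s$-th row of $\widehat F_t$. Moreover the rate $N^{2-2\alpha}/T+N^{1-2\alpha}$ tends to $0$ if and only if $\alpha>1/2$ and $N^{1-\alpha}/\sqrt T\to0$, and in that case the left-hand sides of (i) and (ii) tend to $0$ in probability. (b) Heterogeneous loadings. Let $1\ge\alpha_1\ge\dots\ge\alpha_r>1/2$ and $B_N=\mathrm{diag}(N^{\alpha_1/2},\dots,N^{\alpha_r/2})$,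 and assume $\|B_N^{-1}\Lambda'\Lambda B_N^{-1}-\Sigma_\Lambda\|=O_p(N^{-\alpha_r/2})$ for some positive definite $\Sigma_\Lambda$, $\mathbb E[(\sum_{i=1}^N(N^{-1/2}B_Nf_s)'B_N^{-1}\lambda_ie_{i,t})^2]\le M$ and $\mathbb E\|B_N^{-1}\sum_{i=1}^N\lambda_ie_{i,t}\|^8\le M$. Then all conclusions of (a) hold with $\alpha_r$ in place of $\alpha$. -/

import Mathlib

open MeasureTheory Filter Topology
open scoped NNReal ENNReal Matrix

/- The norm of a matrix is the Frobenius norm `√(tr (A'A))`. The Euclidean norm of a vector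
`v : Fin r → ℝ` is written `‖WithLp.toLp 2 v‖`. -/
attribute [local instance] Matrix.frobeniusNormedAddCommGroup Matrix.frobeniusNormedSpace

noncomputable section

/-! ### Stochastic order -/

/-- `X = O_p(a)` along the filter `l`: for every `ε > 0` there is a constant `C` such that
eventually `P(|X| > C a) ≤ ε`. (`μ` of a non-measurable set is its outer measure.) -/
def IsBigOp {ι Ω : Type*} [MeasurableSpace Ω] (μ : Measure Ω) (l : Filter ι)
    (X : ι → Ω → ℝ) (a : ι → ℝ) : Prop :=
  ∀ ε : ℝ, 0 < ε → ∃ C : ℝ, 0 < C ∧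
    ∀ᶠ i in l, μ {ω | C * a i < |X i ω|} ≤ ENNReal.ofReal ε

/-- `E[Y]` in `[0, ∞]` of a nonnegative random variable `Y`. -/
def expNonneg {Ω : Type*} [MeasurableSpace Ω] (μ : Measure Ω) (Y : Ω → ℝ) : ℝ≥0∞ :=
  ∫⁻ ω, ENNReal.ofReal (Y ω) ∂μ

/-! ### The factor model `X = F Λ' + E`

`f t` is the vector of factors at time `t = 1, 2, …`, `e i t` is the idiosyncratic component of
series `i = 1, 2, …` at time `t`, and `lam N i` is the loading vector of series `i` in a
panel of `N` series. Rows and columns of matrices are numbered from `0`, time periods and series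
from `1`. -/

/-- `F_t = (f_1, …, f_t)'`. -/
def factorMat {Ω : Type*} {r : ℕ} (f : ℕ → Ω → Fin r → ℝ) (t : ℕ) (ω : Ω) :
    Matrix (Fin t) (Fin r) ℝ :=
  Matrix.of fun s j => f (s + 1) ω j

/-- `Λ = (λ_1, …, λ_N)'`. -/
def loadingMat {Ω : Type*} {r : ℕ} (lam : ℕ → ℕ → Ω → Fin r → ℝ) (N : ℕ) (ω : Ω) :
    Matrix (Fin N) (Fin r) ℝ :=
  Matrix.of fun i j => lam N (i + 1) ω j

/-- `E_t`, the `t × N` matrix of idiosyncratic components. -/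
def idioMat {Ω : Type*} (e : ℕ → ℕ → Ω → ℝ) (N t : ℕ) (ω : Ω) : Matrix (Fin t) (Fin N) ℝ :=
  Matrix.of fun s i => e (i + 1) (s + 1) ω

/-- `X_t = F_t Λ' + E_t`, the data available at time `t`. -/
def dataMat {Ω : Type*} {r : ℕ} (f : ℕ → Ω → Fin r → ℝ) (lam : ℕ → ℕ → Ω → Fin r → ℝ)
    (e : ℕ → ℕ → Ω → ℝ) (N t : ℕ) (ω : Ω) : Matrix (Fin t) (Fin N) ℝ :=
  factorMat f t ω * (loadingMat lam N ω)ᵀ + idioMat e N t ω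

/-! ### Principal components -/

/-- `(N t)⁻¹ X X'`. -/
def scaledGram {t N : ℕ} (X : Matrix (Fin t) (Fin N) ℝ) : Matrix (Fin t) (Fin t) ℝ :=
  ((N : ℝ) * (t : ℝ))⁻¹ • (X * Xᵀ)

theorem scaledGram_isHermitian {t N : ℕ} (X : Matrix (Fin t) (Fin N) ℝ) :
    (scaledGram X).IsHermitian := by
  unfold scaledGram
  rw [Matrix.IsHermitian, Matrix.conjTranspose_eq_transpose_of_trivial, Matrix.transpose_smul,
    Matrix.transpose_mul, Matrix.transpose_transpose]

/-- The eigenvalues of `(N t)⁻¹ X X'` with multiplicity in decreasing order: the value at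
`j < t` is the `(j + 1)`-st largest one. (The value at `j ≥ t` is a convention.) -/
def pcEigenvalue {t N : ℕ} (X : Matrix (Fin t) (Fin N) ℝ) (j : ℕ) : ℝ :=
  if h : j < t then
    (scaledGram_isHermitian X).eigenvalues₀ ⟨j, by simpa using h⟩
  else 0

/-- `D²_{Nt,r}`, the diagonal matrix of the `r` largest eigenvalues of `(N t)⁻¹ X X'`. -/
def pcD2 {t N : ℕ} (r : ℕ) (X : Matrix (Fin t) (Fin N) ℝ) : Matrix (Fin r) (Fin r) ℝ :=
  Matrix.diagonal fun j => pcEigenvalue X j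

/-- `Fhat` is a principal components estimate of the factors: `√t` times a `t × r` matrix of
orthonormal eigenvectors of `(N t)⁻¹ X X'` for its `r` largest eigenvalues, in decreasing
order. -/
structure IsPCFactors {t N r : ℕ} (X : Matrix (Fin t) (Fin N) ℝ)
    (Fhat : Matrix (Fin t) (Fin r) ℝ) : Prop where
  normalized : (t : ℝ)⁻¹ • (Fhatᵀ * Fhat) = 1
  eigen : scaledGram X * Fhat = Fhat * pcD2 r X

/-- The rotation `H_{Nt,r} = D_{Nt,r}⁻² (t⁻¹ Fhat_t' F_t) (N⁻¹ Λ' Λ)`. -/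
def rotationMat {t N r : ℕ} (X : Matrix (Fin t) (Fin N) ℝ) (Fhat F : Matrix (Fin t) (Fin r) ℝ)
    (L : Matrix (Fin N) (Fin r) ℝ) : Matrix (Fin r) (Fin r) ℝ :=
  (pcD2 r X)⁻¹ * ((t : ℝ)⁻¹ • (Fhatᵀ * F)) * ((N : ℝ)⁻¹ • (Lᵀ * L))

/-- The last row of a matrix with `t ≥ 1` rows. -/
def lastRow {t r : ℕ} (A : Matrix (Fin t) (Fin r) ℝ) : Fin r → ℝ :=
  if h : 0 < t then A ⟨t - 1, Nat.sub_lt h one_pos⟩ else 0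

/-- `H_{Nt,r}` for the model at the sample point `ω`. -/
def modelRotation {Ω : Type*} {r : ℕ} (f : ℕ → Ω → Fin r → ℝ) (lam : ℕ → ℕ → Ω → Fin r → ℝ)
    (e : ℕ → ℕ → Ω → ℝ) (Fhat : (N t : ℕ) → Ω → Matrix (Fin t) (Fin r) ℝ)
    (N t : ℕ) (ω : Ω) : Matrix (Fin r) (Fin r) ℝ :=
  rotationMat (dataMat f lam e N t ω) (Fhat N t ω) (factorMat f t ω) (loadingMat lam N ω)

/-! ### Sample split -/

/-- `k₀ = ⌊T π₀⌋`. -/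
def splitPoint (π₀ : ℝ) (T : ℕ) : ℕ := ⌊(T : ℝ) * π₀⌋₊

/-- The sums run over `t = ⌊φ₁ T⌋, …, ⌊φ₂ T⌋` inside the out-of-sample period `k₀, …, T - 1`,
and this segment has an asymptotically nonvanishing share of the sample. -/
structure IsOutOfSampleSegment (π₀ : ℝ) (φ₁ φ₂ : ℕ → ℝ) : Prop where
  lower : ∀ᶠ T in atTop, splitPoint π₀ T ≤ ⌊φ₁ T⌋₊
  upper : ∀ᶠ T in atTop, ⌊φ₂ T⌋₊ ≤ T - 1
  shares : ∃ q₁ q₂ : ℝ, q₁ < q₂ ∧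
    Tendsto (fun T : ℕ => (⌊φ₁ T⌋₊ : ℝ) / (T : ℝ)) atTop (𝓝 q₁) ∧
    Tendsto (fun T : ℕ => (⌊φ₂ T⌋₊ : ℝ) / (T : ℝ)) atTop (𝓝 q₂)

/-- `d_T⁻¹ ∑_{t = ⌊φ₁ T⌋}^{⌊φ₂ T⌋} ‖fhat_t - H_{Nt,r} f_t‖²` with
`d_T = ⌊φ₂ T⌋ - ⌊φ₁ T⌋ + 1`, where `fhat_t` is the last row of `Fhat_t`. -/
def outOfSampleError {Ω : Type*} {r : ℕ} (f : ℕ → Ω → Fin r → ℝ)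
    (lam : ℕ → ℕ → Ω → Fin r → ℝ) (e : ℕ → ℕ → Ω → ℝ)
    (Fhat : (N t : ℕ) → Ω → Matrix (Fin t) (Fin r) ℝ) (φ₁ φ₂ : ℕ → ℝ)
    (N T : ℕ) (ω : Ω) : ℝ :=
  ((⌊φ₂ T⌋₊ : ℝ) - (⌊φ₁ T⌋₊ : ℝ) + 1)⁻¹ *
    ∑ t ∈ Finset.Icc ⌊φ₁ T⌋₊ ⌊φ₂ T⌋₊,
      ‖WithLp.toLp 2 (lastRow (Fhat N t ω) - modelRotation f lam e Fhat N t ω *ᵥ f t ω)‖ ^ 2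

/-- `sup_{k₀ ≤ t ≤ T - 1} t⁻¹ ‖Fhat_t - F_t H_{Nt,r}'‖²` (Frobenius norm). -/
def inSampleError {Ω : Type*} {r : ℕ} (f : ℕ → Ω → Fin r → ℝ)
    (lam : ℕ → ℕ → Ω → Fin r → ℝ) (e : ℕ → ℕ → Ω → ℝ)
    (Fhat : (N t : ℕ) → Ω → Matrix (Fin t) (Fin r) ℝ) (π₀ : ℝ) (N T : ℕ) (ω : Ω) : ℝ :=
  ⨆ t : ↥(Finset.Icc (splitPoint π₀ T) (T - 1)),
    ((t : ℕ) : ℝ)⁻¹ *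
      ‖Fhat N t ω - factorMat f t ω * (modelRotation f lam e Fhat N t ω)ᵀ‖ ^ 2

/-- `sup_{k₀ ≤ t ≤ T - 1} t⁻¹ ∑_{s ≤ t} ‖fhat_s - H_{Nt,r} f_s‖²`, where `fhat_s` is the
`s`-th row of `Fhat_t`. -/
def inSampleErrorRows {Ω : Type*} {r : ℕ} (f : ℕ → Ω → Fin r → ℝ)
    (lam : ℕ → ℕ → Ω → Fin r → ℝ) (e : ℕ → ℕ → Ω → ℝ)
    (Fhat : (N t : ℕ) → Ω → Matrix (Fin t) (Fin r) ℝ) (π₀ : ℝ) (N T : ℕ) (ω : Ω) : ℝ :=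
  ⨆ t : ↥(Finset.Icc (splitPoint π₀ T) (T - 1)),
    ((t : ℕ) : ℝ)⁻¹ * ∑ s : Fin t,
      ‖WithLp.toLp 2
        (Fhat N t ω s - modelRotation f lam e Fhat N t ω *ᵥ f ((s : ℕ) + 1) ω)‖ ^ 2

/-! ### Assumptions -/

/-- Factors and idiosyncratic components. -/
structure FactorIdioAssumptions {Ω : Type*} [MeasurableSpace Ω] (μ : Measure Ω)
    (l : Filter (ℕ × ℕ)) (π₀ : ℝ) {r : ℕ} (f : ℕ → Ω → Fin r → ℝ)
    (e : ℕ → ℕ → Ω → ℝ) : Prop where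
  measurable_f : ∀ t, Measurable (f t)
  measurable_e : ∀ i t, Measurable (e i t)
  /-- `sup_{k₀ ≤ t ≤ T - 1} ‖T⁻¹ ∑_{s ≤ t} (f_s f_s' - I_r)‖ = O_p(T^{-1/2})`. -/
  factor_cov : IsBigOp μ l
    (fun p ω => ⨆ t : ↥(Finset.Icc (splitPoint π₀ p.2) (p.2 - 1)),
      ‖(p.2 : ℝ)⁻¹ • ∑ s ∈ Finset.Icc 1 (t : ℕ),
        (Matrix.vecMulVec (f s ω) (f s ω) - (1 : Matrix (Fin r) (Fin r) ℝ))‖)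
    (fun p => (p.2 : ℝ) ^ (-(1 / 2) : ℝ))
  /-- `E(e_{i,t}^4) ≤ M`. -/
  idio_moment : ∃ M : ℝ≥0, ∀ i t, 1 ≤ i → 1 ≤ t → expNonneg μ (fun ω => e i t ω ^ 4) ≤ M
  /-- `E[(N^{-1/2} ∑_i (e_{i,t} e_{i,s} - E(e_{i,t} e_{i,s})))^4] ≤ M`. -/
  idio_cross : ∃ M : ℝ≥0, ∀ N t s : ℕ, 1 ≤ t → 1 ≤ s →
    expNonneg μ (fun ω => ((N : ℝ) ^ (-(1 / 2) : ℝ) *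
      ∑ i ∈ Finset.Icc 1 N, (e i t ω * e i s ω - ∫ ω', e i t ω' * e i s ω' ∂μ)) ^ 4) ≤ M
  /-- `T⁻¹ ∑_{t ≤ T} ∑_{s ≤ T} [E(e_{i,t} e_{i,s})]² ≤ M`. -/
  idio_summable : ∃ M : ℝ≥0, ∀ i T : ℕ, 1 ≤ i →
    (T : ℝ)⁻¹ * ∑ t ∈ Finset.Icc 1 T, ∑ s ∈ Finset.Icc 1 T,
      (∫ ω, e i t ω * e i s ω ∂μ) ^ 2 ≤ M

/-- Homogeneously weak loadings of strength `α`. -/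
structure HomogeneousLoadings {Ω : Type*} [MeasurableSpace Ω] (μ : Measure Ω)
    (l : Filter (ℕ × ℕ)) {r : ℕ} (f : ℕ → Ω → Fin r → ℝ) (e : ℕ → ℕ → Ω → ℝ)
    (lam : ℕ → ℕ → Ω → Fin r → ℝ) (α : ℝ) : Prop where
  /-- `‖N^{-α} Λ'Λ - Σ_Λ‖ = O_p(N^{-α/2})` for a positive definite `Σ_Λ`. -/
  gram : ∃ S : Matrix (Fin r) (Fin r) ℝ, S.PosDef ∧
    IsBigOp μ l
      (fun p ω => ‖(p.1 : ℝ) ^ (-α) • ((loadingMat lam p.1 ω)ᵀ * loadingMat lam p.1 ω) - S‖)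
      (fun p => (p.1 : ℝ) ^ (-α / 2))
  /-- `E[(N^{-α/2} ∑_i f_s'λ_i e_{i,t})²] ≤ M`. -/
  cross : ∃ M : ℝ≥0, ∀ N s t : ℕ, 1 ≤ s → 1 ≤ t →
    expNonneg μ (fun ω => ((N : ℝ) ^ (-α / 2) *
      ∑ i ∈ Finset.Icc 1 N, (f s ω ⬝ᵥ lam N i ω) * e i t ω) ^ 2) ≤ M
  /-- `E(‖N^{-α/2} ∑_i λ_i e_{i,t}‖^8) ≤ M`. -/
  weighted : ∃ M : ℝ≥0, ∀ N t : ℕ, 1 ≤ t →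
    expNonneg μ (fun ω => ‖WithLp.toLp 2 ((N : ℝ) ^ (-α / 2) •
      ∑ i ∈ Finset.Icc 1 N, e i t ω • lam N i ω)‖ ^ 8) ≤ M

/-- `B_N = diag(N^{α_1/2}, …, N^{α_r/2})`. -/
def strengthMat {r : ℕ} (α : Fin r → ℝ) (N : ℕ) : Matrix (Fin r) (Fin r) ℝ :=
  Matrix.diagonal fun j => (N : ℝ) ^ (α j / 2)

/-- Heterogeneously weak loadings of strengths `α_1 ≥ ⋯ ≥ α_r`; `αr` is the smallest. -/
structure HeterogeneousLoadings {Ω : Type*} [MeasurableSpace Ω] (μ : Measure Ω)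
    (l : Filter (ℕ × ℕ)) {r : ℕ} (f : ℕ → Ω → Fin r → ℝ) (e : ℕ → ℕ → Ω → ℝ)
    (lam : ℕ → ℕ → Ω → Fin r → ℝ) (α : Fin r → ℝ) (αr : ℝ) : Prop where
  /-- `‖B_N⁻¹ Λ'Λ B_N⁻¹ - Σ_Λ‖ = O_p(N^{-α_r/2})` for a positive definite `Σ_Λ`. -/
  gram : ∃ S : Matrix (Fin r) (Fin r) ℝ, S.PosDef ∧
    IsBigOp μ l
      (fun p ω => ‖(strengthMat α p.1)⁻¹ *
        ((loadingMat lam p.1 ω)ᵀ * loadingMat lam p.1 ω) * (strengthMat α p.1)⁻¹ - S‖)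
      (fun p => (p.1 : ℝ) ^ (-αr / 2))
  /-- `E[(∑_i (N^{-1/2} B_N f_s)' B_N⁻¹ λ_i e_{i,t})²] ≤ M`. -/
  cross : ∃ M : ℝ≥0, ∀ N s t : ℕ, 1 ≤ s → 1 ≤ t →
    expNonneg μ (fun ω => (∑ i ∈ Finset.Icc 1 N,
      (((N : ℝ) ^ (-(1 / 2) : ℝ) • (strengthMat α N *ᵥ f s ω)) ⬝ᵥ
        ((strengthMat α N)⁻¹ *ᵥ lam N i ω)) * e i t ω) ^ 2) ≤ M
  /-- `E(‖B_N⁻¹ ∑_i λ_i e_{i,t}‖^8) ≤ M`. -/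
  weighted : ∃ M : ℝ≥0, ∀ N t : ℕ, 1 ≤ t →
    expNonneg μ (fun ω => ‖WithLp.toLp 2 ((strengthMat α N)⁻¹ *ᵥ
      ∑ i ∈ Finset.Icc 1 N, e i t ω • lam N i ω)‖ ^ 8) ≤ M

/-! ### The conclusion -/

/-- The rates for loadings whose (smallest) strength is `a`. -/
structure PCRates {Ω : Type*} [MeasurableSpace Ω] (μ : Measure Ω) (l : Filter (ℕ × ℕ))
    (π₀ : ℝ) {r : ℕ} (f : ℕ → Ω → Fin r → ℝ) (e : ℕ → ℕ → Ω → ℝ)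
    (lam : ℕ → ℕ → Ω → Fin r → ℝ) (Fhat : (N t : ℕ) → Ω → Matrix (Fin t) (Fin r) ℝ)
    (a : ℝ) : Prop where
  /-- With probability tending to one, the inverses in `H_{Nt,r}`, `k₀ ≤ t ≤ T - 1`, exist. -/
  wellDefined : Tendsto
    (fun p : ℕ × ℕ => μ {ω | ∃ t ∈ Finset.Icc (splitPoint π₀ p.2) (p.2 - 1),
      ¬ IsUnit (pcD2 r (dataMat f lam e p.1 t ω)).det}) l (𝓝 0)
  /-- The out-of-sample average is `O_p(N^{2-2a}/T) + O_p(N^{1-2a})` on every segment. -/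
  outOfSample : ∀ φ₁ φ₂ : ℕ → ℝ, IsOutOfSampleSegment π₀ φ₁ φ₂ →
    IsBigOp μ l (fun p ω => outOfSampleError f lam e Fhat φ₁ φ₂ p.1 p.2 ω)
      (fun p => (p.1 : ℝ) ^ (2 - 2 * a) / (p.2 : ℝ) + (p.1 : ℝ) ^ (1 - 2 * a))
  /-- The uniform in-sample error is `O_p(N^{2-2a}/k₀) + O_p(N^{1-2a})`. -/
  inSample : IsBigOp μ l (fun p ω => inSampleError f lam e Fhat π₀ p.1 p.2 ω)
      (fun p => (p.1 : ℝ) ^ (2 - 2 * a) / (splitPoint π₀ p.2 : ℝ) + (p.1 : ℝ) ^ (1 - 2 * a))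
  /-- The in-sample error is an average of row errors. -/
  inSample_rows : ∀ (N T : ℕ) (ω : Ω),
    inSampleError f lam e Fhat π₀ N T ω = inSampleErrorRows f lam e Fhat π₀ N T ω
  /-- The rate vanishes if and only if `a > 1/2` and `N^{1-a}/√T → 0`. -/
  rate_vanishes_iff :
    Tendsto (fun p : ℕ × ℕ => (p.1 : ℝ) ^ (2 - 2 * a) / (p.2 : ℝ) + (p.1 : ℝ) ^ (1 - 2 * a))
        l (𝓝 0) ↔
      1 / 2 < a ∧ Tendsto (fun p : ℕ × ℕ => (p.1 : ℝ) ^ (1 - a) / √(p.2 : ℝ)) l (𝓝 0)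
  /-- In that case both errors vanish in probability. -/
  consistent : 1 / 2 < a →
    Tendsto (fun p : ℕ × ℕ => (p.1 : ℝ) ^ (1 - a) / √(p.2 : ℝ)) l (𝓝 0) →
    (∀ φ₁ φ₂ : ℕ → ℝ, IsOutOfSampleSegment π₀ φ₁ φ₂ →
      TendstoInMeasure μ (fun p : ℕ × ℕ => outOfSampleError f lam e Fhat φ₁ φ₂ p.1 p.2) l
        (fun _ => 0)) ∧
    TendstoInMeasure μ (fun p : ℕ × ℕ => inSampleError f lam e Fhat π₀ p.1 p.2) l (fun _ => 0)

end

/-! Substitute `X = FΛ' + E` into the eigenvector equation. The rotation `H` is chosen so that the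
pure factor part cancels, which leaves the exact identity `(F̂ - F H') D² = (N t)⁻¹ R F̂` with `R =
FΛ'E' + EΛF' + EE'` (`IsPCFactors.sub_mul_pcD2`). If all `r` leading eigenvalues are at least `δ`,
Cauchy-Schwarz bounds the squared error of row `s` by `r t (N t δ)⁻²` times the squared norm of row
`s` of `R` (`IsPCFactors.row_error_le`). Two estimates remain.

Size of `R`. Summing second moments over all pairs of periods up to `T` gives `E‖R‖² = O(T² N + N²
T)`: the cross terms and the centred part of `EE'` give the first order, the autocovariances give
the second (`measure_errorSum_le`).

Size of `δ`. Min-max on the column space of `F` gives `δ` of order `N^(a-1)`, because `F'F` is at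
least `t/2` and `Λ'Λ` at least `c N^a`. The term `EE'` is positive semidefinite and can be dropped,
so only `FΛ'E'`, of order `T N^(b/2)`, must be dominated by `N^a T`; this is where `b < 2a` enters
(`le_pcEigenvalue`, `FactorIdioAssumptions.wellBehaved`). Homogeneous loadings have `a = b = α`;
heterogeneous ones have `a = α_r > 1/2` and `b = 1`.

Together, `(N T N^(a-1))⁻² (T² N + N² T) = N^(1-2a) + N^(2-2a)/T`. Uniformity in `t` needs no
maximal inequality: the entries of `R` do not depend on `t`, so every `R` is a corner of the one for
`T`, and a single Markov bound serves all `t`. The same remark handles the out-of-sample average, in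
which each `t` uses only its own row of `R`. -/

/-! ### Frobenius norm and quadratic forms -/

theorem norm_toLp_sq_eq_sum {n : Type*} [Fintype n] (v : n → ℝ) :
    ‖WithLp.toLp 2 v‖ ^ 2 = ∑ i, v i ^ 2 := by
  rw [EuclideanSpace.norm_sq_eq]
  simp

theorem dotProduct_self_eq_sum_sq {n : Type*} [Fintype n] (v : n → ℝ) :
    v ⬝ᵥ v = ∑ i, v i ^ 2 := by
  simp [dotProduct, sq]

theorem frobenius_norm_sq_eq_sum {m n : Type*} [Fintype m] [Fintype n] (A : Matrix m n ℝ) :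
    ‖A‖ ^ 2 = ∑ i, ∑ j, A i j ^ 2 := by
  rw [Matrix.frobenius_norm_def, ← Real.sqrt_eq_rpow, Real.sq_sqrt (by positivity)]
  simp

theorem dotProduct_sq_le {n : Type*} [Fintype n] (v w : n → ℝ) :
    (v ⬝ᵥ w) ^ 2 ≤ (v ⬝ᵥ v) * (w ⬝ᵥ w) := by
  rw [dotProduct_self_eq_sum_sq, dotProduct_self_eq_sum_sq]
  exact Finset.sum_mul_sq_le_sq_mul_sq _ _ _

theorem dotProduct_self_nonneg_real {n : Type*} [Fintype n] (v : n → ℝ) : 0 ≤ v ⬝ᵥ v := by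
  rw [dotProduct_self_eq_sum_sq]
  positivity

theorem mulVec_dotProduct_self_le {m n : Type*} [Fintype m] [Fintype n] (A : Matrix m n ℝ)
    (v : n → ℝ) : (A *ᵥ v) ⬝ᵥ (A *ᵥ v) ≤ ‖A‖ ^ 2 * (v ⬝ᵥ v) := by
  rw [frobenius_norm_sq_eq_sum, dotProduct_self_eq_sum_sq, Finset.sum_mul]
  refine Finset.sum_le_sum fun i _ => ?_
  rw [← dotProduct_self_eq_sum_sq]
  exact dotProduct_sq_le _ _

theorem abs_quadraticForm_le {n : Type*} [Fintype n] (A : Matrix n n ℝ) (v : n → ℝ) :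
    |v ⬝ᵥ A *ᵥ v| ≤ ‖A‖ * (v ⬝ᵥ v) := by
  refine abs_le_of_sq_le_sq ?_ (mul_nonneg (norm_nonneg _) (dotProduct_self_nonneg_real v))
  calc (v ⬝ᵥ A *ᵥ v) ^ 2 ≤ (v ⬝ᵥ v) * ((A *ᵥ v) ⬝ᵥ (A *ᵥ v)) := dotProduct_sq_le _ _
    _ ≤ (v ⬝ᵥ v) * (‖A‖ ^ 2 * (v ⬝ᵥ v)) :=
        mul_le_mul_of_nonneg_left (mulVec_dotProduct_self_le A v) (dotProduct_self_nonneg_real v)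
    _ = (‖A‖ * (v ⬝ᵥ v)) ^ 2 := by ring

theorem Matrix.PosDef.exists_pos_mul_le {n : Type*} [Fintype n] {S : Matrix n n ℝ}
    (hS : S.PosDef) : ∃ c : ℝ, 0 < c ∧ ∀ w : n → ℝ, c * (w ⬝ᵥ w) ≤ w ⬝ᵥ S *ᵥ w := by
  classical
  rcases isEmpty_or_nonempty n with h | h
  · exact ⟨1, one_pos, fun w => by simp [dotProduct]⟩
  · have hpos : ∀ i, 0 < hS.isHermitian.eigenvalues i := hS.eigenvalues_pos
    obtain ⟨i₀, hi₀⟩ := Finite.exists_min hS.isHermitian.eigenvalues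
    refine ⟨_, hpos i₀, fun w => ?_⟩
    have hsymm := Matrix.isSymmetric_toEuclideanLin_iff.mpr hS.isHermitian
    set b := hS.isHermitian.eigenvectorBasis
    set x : EuclideanSpace ℝ n := WithLp.toLp 2 w
    have h1 : w ⬝ᵥ S *ᵥ w = inner ℝ (Matrix.toEuclideanLin S x) x := by
      simp [x, EuclideanSpace.inner_eq_star_dotProduct]
    have h2 : w ⬝ᵥ w = inner ℝ x x := by
      rw [real_inner_self_eq_norm_sq, norm_toLp_sq_eq_sum, dotProduct_self_eq_sum_sq]
    have hb : ∀ i, Matrix.toEuclideanLin S (b i) = hS.isHermitian.eigenvalues i • b i := by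
      intro i
      have := hS.isHermitian.mulVec_eigenvectorBasis i
      ext k
      simpa [Matrix.toLpLin_apply] using congrFun this k
    rw [h1, h2, ← b.sum_inner_mul_inner, ← b.sum_inner_mul_inner (Matrix.toEuclideanLin S x),
      Finset.mul_sum]
    refine Finset.sum_le_sum fun i _ => ?_
    rw [hsymm x (b i), hb, real_inner_smul_right, real_inner_comm (b i) x]
    nlinarith [hi₀ i, mul_self_nonneg (inner ℝ (b i) x)]

/-! ### A min-max bound -/

/-- A quadratic form that is at least `c` on a space of dimension greater than `j` has its
`j`-th eigenvalue (counted from `0`, in decreasing order) at least `c`. -/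
theorem LinearMap.IsSymmetric.le_eigenvalues_of_le_on_range {E V : Type*}
    [NormedAddCommGroup E] [InnerProductSpace ℝ E] [FiniteDimensional ℝ E]
    [AddCommGroup V] [Module ℝ V] [FiniteDimensional ℝ V]
    {T : E →ₗ[ℝ] E} (hT : T.IsSymmetric) {n : ℕ} (hn : Module.finrank ℝ E = n)
    (g : V →ₗ[ℝ] E) (hg : Function.Injective g) {c : ℝ}
    (h : ∀ a, c * inner ℝ (g a) (g a) ≤ inner ℝ (T (g a)) (g a))
    (j : Fin n) (hj : (j : ℕ) < Module.finrank ℝ V) : c ≤ hT.eigenvalues hn j := by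
  set b := hT.eigenvectorBasis hn
  let ψ : V →ₗ[ℝ] (Fin j → ℝ) :=
    LinearMap.pi fun i => (innerₛₗ ℝ (b ⟨i, i.2.trans j.2⟩)) ∘ₗ g
  -- Only `j` linear conditions are imposed on a space of dimension greater than `j`, so some
  -- nonzero vector of the range is orthogonal to the top `j` eigenvectors; on it the form is at
  -- most the `j`-th eigenvalue times the squared norm.
  obtain ⟨a, ha, ha0⟩ := (Submodule.ne_bot_iff _).1
    (LinearMap.ker_ne_bot_of_finrank_lt (f := ψ) (by simpa using hj))
  have hperp : ∀ i : Fin n, i < j → inner ℝ (b i) (g a) = 0 := by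
    intro i hi
    have := congrFun (LinearMap.mem_ker.1 ha) ⟨i, hi⟩
    simpa [ψ] using this
  have hpos : 0 < inner ℝ (g a) (g a) := by
    rw [real_inner_self_eq_norm_sq]
    have : g a ≠ 0 := fun h0 => ha0 (hg (by simpa using h0))
    positivity
  have hup : inner ℝ (T (g a)) (g a) ≤ hT.eigenvalues hn j * inner ℝ (g a) (g a) := by
    rw [← b.sum_inner_mul_inner, ← b.sum_inner_mul_inner (g a) (g a), Finset.mul_sum]
    refine Finset.sum_le_sum fun i _ => ?_
    rw [hT (g a) (b i), hT.apply_eigenvectorBasis, RCLike.ofReal_real_eq_id, id_eq,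
      real_inner_smul_right, real_inner_comm (b i) (g a)]
    rcases lt_or_ge i j with hi | hi
    · rw [hperp i hi]
      simp
    · nlinarith [hT.eigenvalues_antitone hn hi, mul_self_nonneg (inner ℝ (b i) (g a))]
  exact le_of_mul_le_mul_right ((h a).trans hup) hpos

/-! ### Deterministic bounds for principal components -/

/-- Test the form of `XX'` on `v = F a`: it equals `|ΛF'v|² + 2 v'FΛ'E'v + |E'v|²`. The first term
is at least `κτ|v|²`, the second at least `-2η|v|²`, and the third is nonnegative. No bound on the
norm of `EE'` is needed. -/
theorem le_pcEigenvalue {t N r : ℕ} (ht : 0 < t) (hN : 0 < N) (hrt : r ≤ t)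
    (F : Matrix (Fin t) (Fin r) ℝ) (L : Matrix (Fin N) (Fin r) ℝ) (E : Matrix (Fin t) (Fin N) ℝ)
    {τ κ η : ℝ} (hτ : 0 < τ) (hκ : 0 ≤ κ)
    (hF : ∀ a, τ * (a ⬝ᵥ a) ≤ (F *ᵥ a) ⬝ᵥ (F *ᵥ a))
    (hL : ∀ w, κ * (w ⬝ᵥ w) ≤ (L *ᵥ w) ⬝ᵥ (L *ᵥ w))
    (hη : ‖F * Lᵀ * Eᵀ‖ ≤ η) {j : ℕ} (hj : j < r) :
    ((N : ℝ) * t)⁻¹ * (κ * τ - 2 * η) ≤ pcEigenvalue (F * Lᵀ + E) j := by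
  have hinj : Function.Injective (Matrix.toLpLin 2 2 F ∘ₗ
      (WithLp.linearEquiv 2 ℝ (Fin r → ℝ)).symm.toLinearMap) := by
    rw [injective_iff_map_eq_zero]
    intro a ha
    have h0 : F *ᵥ a = 0 := by
      ext k
      simpa [Matrix.toLpLin_apply] using congrArg (fun x => x k) ha
    have h1 := hF a
    rw [h0, dotProduct_zero] at h1
    exact dotProduct_self_eq_zero.1
      (le_antisymm (by nlinarith) (dotProduct_self_nonneg_real a))
  rw [pcEigenvalue, dif_pos (hj.trans_le hrt)]
  refine LinearMap.IsSymmetric.le_eigenvalues_of_le_on_range _ _ _ hinj (fun a => ?_) _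
    (by simpa using hj)
  set v := F *ᵥ a with hv
  have e1 : (Matrix.toLpLin 2 2 F ∘ₗ
      (WithLp.linearEquiv 2 ℝ (Fin r → ℝ)).symm.toLinearMap) a = WithLp.toLp 2 v := by
    simp [hv, Matrix.toLpLin_apply]
  have e2 : inner ℝ (WithLp.toLp 2 v) (WithLp.toLp 2 v) = v ⬝ᵥ v := by
    rw [real_inner_self_eq_norm_sq, norm_toLp_sq_eq_sum, dotProduct_self_eq_sum_sq]
  have e3 : inner ℝ (Matrix.toEuclideanLin (scaledGram (F * Lᵀ + E)) (WithLp.toLp 2 v))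
      (WithLp.toLp 2 v) = v ⬝ᵥ scaledGram (F * Lᵀ + E) *ᵥ v := by
    simp [EuclideanSpace.inner_eq_star_dotProduct]
  rw [e1, e2, e3]
  have e4 : v ⬝ᵥ scaledGram (F * Lᵀ + E) *ᵥ v = ((N : ℝ) * t)⁻¹ *
      ((L *ᵥ (Fᵀ *ᵥ v)) ⬝ᵥ (L *ᵥ (Fᵀ *ᵥ v)) + 2 * (v ⬝ᵥ (F * Lᵀ * Eᵀ) *ᵥ v)
        + (Eᵀ *ᵥ v) ⬝ᵥ (Eᵀ *ᵥ v)) := by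
    have g1 : v ⬝ᵥ ((F * Lᵀ + E) * (F * Lᵀ + E)ᵀ) *ᵥ v =
        ((F * Lᵀ + E)ᵀ *ᵥ v) ⬝ᵥ ((F * Lᵀ + E)ᵀ *ᵥ v) := by
      rw [← Matrix.mulVec_mulVec, Matrix.dotProduct_mulVec, ← Matrix.mulVec_transpose]
    have g2 : v ⬝ᵥ (F * Lᵀ * Eᵀ) *ᵥ v = (L *ᵥ (Fᵀ *ᵥ v)) ⬝ᵥ (Eᵀ *ᵥ v) := by
      rw [← Matrix.mulVec_mulVec, Matrix.dotProduct_mulVec, ← Matrix.mulVec_transpose]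
      simp [Matrix.transpose_mul, Matrix.mulVec_mulVec]
    have g3 : (F * Lᵀ + E)ᵀ *ᵥ v = L *ᵥ (Fᵀ *ᵥ v) + Eᵀ *ᵥ v := by
      simp [Matrix.transpose_add, Matrix.transpose_mul, Matrix.add_mulVec, Matrix.mulVec_mulVec]
    rw [scaledGram, Matrix.smul_mulVec, dotProduct_smul, smul_eq_mul, g1, g2, g3,
      add_dotProduct, dotProduct_add, dotProduct_add,
      dotProduct_comm (Eᵀ *ᵥ v) (L *ᵥ (Fᵀ *ᵥ v))]
    ring
  rw [e4, mul_assoc]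
  refine mul_le_mul_of_nonneg_left ?_ (by positivity)
  have hv0 := dotProduct_self_nonneg_real v
  have ha0 := dotProduct_self_nonneg_real a
  have h1 := hL (Fᵀ *ᵥ v)
  have h2 := abs_quadraticForm_le (F * Lᵀ * Eᵀ) v
  have h3 : ‖F * Lᵀ * Eᵀ‖ * (v ⬝ᵥ v) ≤ η * (v ⬝ᵥ v) := mul_le_mul_of_nonneg_right hη hv0
  have h4 := neg_abs_le (v ⬝ᵥ (F * Lᵀ * Eᵀ) *ᵥ v)
  have h5 := dotProduct_self_nonneg_real (Eᵀ *ᵥ v)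
  -- The bound `F'F ≥ τ` transfers to `FF'` on the range of `F`: `|v|² = a'F'v` gives `|v|⁴ ≤
  -- |a|²|F'v|²`, while `τ|a|² ≤ |v|²`; one factor `|v|²` then cancels.
  have h6 : τ * (v ⬝ᵥ v) ≤ (Fᵀ *ᵥ v) ⬝ᵥ (Fᵀ *ᵥ v) := by
    have k1 : v ⬝ᵥ v = a ⬝ᵥ (Fᵀ *ᵥ v) := by
      rw [Matrix.mulVec_transpose, dotProduct_comm a, ← Matrix.dotProduct_mulVec, ← hv]
    have k2 := dotProduct_sq_le a (Fᵀ *ᵥ v)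
    rw [← k1] at k2
    have k3 := hF a
    have k4 := dotProduct_self_nonneg_real (Fᵀ *ᵥ v)
    rcases hv0.eq_or_lt with h0 | h0
    · rw [← h0, mul_zero]
      exact k4
    · refine le_of_mul_le_mul_right ?_ h0
      calc τ * (v ⬝ᵥ v) * (v ⬝ᵥ v) = τ * (v ⬝ᵥ v) ^ 2 := by ring
        _ ≤ τ * ((a ⬝ᵥ a) * ((Fᵀ *ᵥ v) ⬝ᵥ (Fᵀ *ᵥ v))) := by gcongr
        _ = (τ * (a ⬝ᵥ a)) * ((Fᵀ *ᵥ v) ⬝ᵥ (Fᵀ *ᵥ v)) := by ring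
        _ ≤ (v ⬝ᵥ v) * ((Fᵀ *ᵥ v) ⬝ᵥ (Fᵀ *ᵥ v)) := by gcongr
        _ = _ := by ring
  have h7 := mul_le_mul_of_nonneg_left h6 hκ
  nlinarith

/-- By definition of the rotation, `F H' D² = (N t)⁻¹ FΛ'ΛF'F̂`, which is exactly the noise-free
part of `(N t)⁻¹ XX'F̂ = F̂ D²`. -/
theorem IsPCFactors.sub_mul_pcD2 {t N r : ℕ} {F Fhat : Matrix (Fin t) (Fin r) ℝ}
    {L : Matrix (Fin N) (Fin r) ℝ} {E : Matrix (Fin t) (Fin N) ℝ}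
    (h : IsPCFactors (F * Lᵀ + E) Fhat) (hD : IsUnit (pcD2 r (F * Lᵀ + E)).det) :
    (Fhat - F * (rotationMat (F * Lᵀ + E) Fhat F L)ᵀ) * pcD2 r (F * Lᵀ + E) =
      ((N : ℝ) * t)⁻¹ • ((F * Lᵀ * Eᵀ + E * L * Fᵀ + E * Eᵀ) * Fhat) := by
  have hDt : (pcD2 r (F * Lᵀ + E))ᵀ = pcD2 r (F * Lᵀ + E) := Matrix.diagonal_transpose _
  have hH : (rotationMat (F * Lᵀ + E) Fhat F L)ᵀ * pcD2 r (F * Lᵀ + E) =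
      ((N : ℝ) * t)⁻¹ • (Lᵀ * L * (Fᵀ * Fhat)) := by
    rw [rotationMat, Matrix.transpose_mul, Matrix.transpose_mul, Matrix.transpose_nonsing_inv,
      hDt, Matrix.mul_assoc, Matrix.mul_assoc, Matrix.nonsing_inv_mul _ hD, Matrix.mul_one]
    simp [Matrix.transpose_mul, smul_smul, mul_comm]
  rw [Matrix.sub_mul, Matrix.mul_assoc, hH, ← h.eigen, scaledGram, Matrix.smul_mul,
    Matrix.mul_smul, ← smul_sub]
  congr 1
  simp only [Matrix.transpose_add, Matrix.transpose_mul, Matrix.transpose_transpose,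
    Matrix.add_mul, Matrix.mul_add, Matrix.mul_assoc]
  abel

/-- `D²` is diagonal, so the identity splits into scalar equations that can be divided by single
eigenvalues. Cauchy-Schwarz against a column of `Fhat`, whose squared norm is `t`, bounds each of
the `r` entries. -/
theorem IsPCFactors.row_error_le {t N r : ℕ} (ht : 0 < t) {F Fhat : Matrix (Fin t) (Fin r) ℝ}
    {L : Matrix (Fin N) (Fin r) ℝ} {E : Matrix (Fin t) (Fin N) ℝ}
    (h : IsPCFactors (F * Lᵀ + E) Fhat) {δ : ℝ} (hδ : 0 < δ)
    (hD : ∀ j, j < r → δ ≤ pcEigenvalue (F * Lᵀ + E) j) (s : Fin t) :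
    ∑ j, (Fhat s j - (rotationMat (F * Lᵀ + E) Fhat F L *ᵥ F s) j) ^ 2 ≤
      r * t * (N * t * δ)⁻¹ ^ 2 * ∑ u, (F * Lᵀ * Eᵀ + E * L * Fᵀ + E * Eᵀ) s u ^ 2 := by
  have hunit : IsUnit (pcD2 r (F * Lᵀ + E)).det := by
    rw [pcD2, Matrix.det_diagonal, isUnit_iff_ne_zero]
    exact Finset.prod_ne_zero_iff.2 fun j _ => (hδ.trans_le (hD j j.2)).ne'
  have key := h.sub_mul_pcD2 hunit
  set R := F * Lᵀ * Eᵀ + E * L * Fᵀ + E * Eᵀ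
  set H := rotationMat (F * Lᵀ + E) Fhat F L
  have hcol : ∀ j, ∑ u, Fhat u j ^ 2 = t := by
    intro j
    have := congrFun (congrFun h.normalized j) j
    simp only [Matrix.smul_apply, Matrix.mul_apply, Matrix.transpose_apply, smul_eq_mul,
      Matrix.one_apply_eq, ← sq] at this
    field_simp at this
    exact this
  have hentry : ∀ j, (Fhat s j - (H *ᵥ F s) j) ^ 2 ≤ t * (N * t * δ)⁻¹ ^ 2 * ∑ u, R s u ^ 2 := by
    intro j
    have e1 := congrFun (congrFun key s) j
    rw [pcD2, Matrix.mul_diagonal, Matrix.smul_apply, Matrix.mul_apply, smul_eq_mul,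
      Matrix.sub_apply] at e1
    have e2 : (F * Hᵀ) s j = (H *ᵥ F s) j := by
      simp [Matrix.mul_apply, Matrix.mulVec, dotProduct, mul_comm]
    rw [e2] at e1
    set d := Fhat s j - (H *ᵥ F s) j
    have hm := hD j j.2
    have cs : (∑ u, R s u * Fhat u j) ^ 2 ≤ (∑ u, R s u ^ 2) * t := by
      rw [← hcol j]
      exact Finset.sum_mul_sq_le_sq_mul_sq _ _ _
    have h1 : (d * δ) ^ 2 ≤ ((N : ℝ) * t)⁻¹ ^ 2 * ((∑ u, R s u ^ 2) * t) := by
      calc (d * δ) ^ 2 = d ^ 2 * δ ^ 2 := by ring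
        _ ≤ d ^ 2 * (pcEigenvalue (F * Lᵀ + E) j) ^ 2 := by gcongr
        _ = (d * pcEigenvalue (F * Lᵀ + E) j) ^ 2 := by ring
        _ = ((N : ℝ) * t)⁻¹ ^ 2 * (∑ u, R s u * Fhat u j) ^ 2 := by rw [e1]; ring
        _ ≤ _ := by gcongr
    calc d ^ 2 = δ⁻¹ ^ 2 * (d * δ) ^ 2 := by field_simp
      _ ≤ δ⁻¹ ^ 2 * (((N : ℝ) * t)⁻¹ ^ 2 * ((∑ u, R s u ^ 2) * t)) := by gcongr
      _ = _ := by rw [mul_inv _ δ]; ring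
  calc _ ≤ ∑ _j : Fin r, (t * (N * t * δ)⁻¹ ^ 2 * ∑ u, R s u ^ 2) :=
        Finset.sum_le_sum fun j _ => hentry j
    _ = _ := by
        rw [Finset.sum_const, Finset.card_univ, Fintype.card_fin, nsmul_eq_mul]
        ring

/-! ### Expectations of nonnegative random variables -/

theorem expNonneg_mono {Ω : Type*} [MeasurableSpace Ω] {μ : Measure Ω} {Y Z : Ω → ℝ}
    (h : ∀ ω, Y ω ≤ Z ω) : expNonneg μ Y ≤ expNonneg μ Z :=
  lintegral_mono fun ω => ENNReal.ofReal_le_ofReal (h ω)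

theorem expNonneg_sum {Ω ι : Type*} [MeasurableSpace Ω] {μ : Measure Ω} (s : Finset ι)
    {Y : ι → Ω → ℝ} (hY : ∀ i, Measurable (Y i)) (h0 : ∀ i ω, 0 ≤ Y i ω) :
    expNonneg μ (fun ω => ∑ i ∈ s, Y i ω) = ∑ i ∈ s, expNonneg μ (Y i) := by
  unfold expNonneg
  rw [← lintegral_finsetSum s fun i _ => (hY i).ennreal_ofReal]
  exact lintegral_congr fun ω => ENNReal.ofReal_sum_of_nonneg fun i _ => h0 i ω

theorem expNonneg_sum_le {Ω ι : Type*} [MeasurableSpace Ω] {μ : Measure Ω} (s : Finset ι)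
    {Y : ι → Ω → ℝ} (hY : ∀ i, Measurable (Y i)) (h0 : ∀ i ω, 0 ≤ Y i ω) {B : ι → ℝ}
    (hB0 : ∀ i ∈ s, 0 ≤ B i) (hB : ∀ i ∈ s, expNonneg μ (Y i) ≤ ENNReal.ofReal (B i)) :
    expNonneg μ (fun ω => ∑ i ∈ s, Y i ω) ≤ ENNReal.ofReal (∑ i ∈ s, B i) := by
  rw [expNonneg_sum s hY h0, ENNReal.ofReal_sum_of_nonneg hB0]
  exact Finset.sum_le_sum hB

theorem expNonneg_add_le {Ω : Type*} [MeasurableSpace Ω] {μ : Measure Ω} {Y Z : Ω → ℝ}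
    (hY : Measurable Y) {a b : ℝ} (ha : 0 ≤ a) (hb : 0 ≤ b)
    (hYa : expNonneg μ Y ≤ ENNReal.ofReal a) (hZb : expNonneg μ Z ≤ ENNReal.ofReal b) :
    expNonneg μ (fun ω => Y ω + Z ω) ≤ ENNReal.ofReal (a + b) := by
  calc expNonneg μ (fun ω => Y ω + Z ω)
      ≤ ∫⁻ ω, (ENNReal.ofReal (Y ω) + ENNReal.ofReal (Z ω)) ∂μ :=
        lintegral_mono fun ω => ENNReal.ofReal_add_le
    _ = expNonneg μ Y + expNonneg μ Z := lintegral_add_left hY.ennreal_ofReal _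
    _ ≤ _ := by
        rw [ENNReal.ofReal_add ha hb]
        exact add_le_add hYa hZb

theorem expNonneg_const_mul_le {Ω : Type*} [MeasurableSpace Ω] {μ : Measure Ω} {Y : Ω → ℝ}
    (hY : Measurable Y) {k a : ℝ} (hk : 0 ≤ k) (hYa : expNonneg μ Y ≤ ENNReal.ofReal a) :
    expNonneg μ (fun ω => k * Y ω) ≤ ENNReal.ofReal (k * a) := by
  unfold expNonneg
  simp_rw [ENNReal.ofReal_mul hk]
  rw [lintegral_const_mul _ hY.ennreal_ofReal]
  gcongr
  exact hYa

theorem expNonneg_const {Ω : Type*} [MeasurableSpace Ω] {μ : Measure Ω} [IsProbabilityMeasure μ]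
    (k : ℝ) : expNonneg μ (fun _ => k) = ENNReal.ofReal k := by
  simp [expNonneg]

/-- Markov's inequality. -/
theorem measure_lt_le_of_expNonneg_le {Ω : Type*} [MeasurableSpace Ω] {μ : Measure Ω}
    {Y : Ω → ℝ} (hY : Measurable Y) {B ε : ℝ} (hB : 0 < B) (hε : 0 < ε)
    (h : expNonneg μ Y ≤ ENNReal.ofReal B) : μ {ω | B / ε < Y ω} ≤ ENNReal.ofReal ε := by
  have hpos : 0 < B / ε := div_pos hB hε
  calc μ {ω | B / ε < Y ω} ≤ μ {ω | ENNReal.ofReal (B / ε) ≤ ENNReal.ofReal (Y ω)} :=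
        measure_mono fun ω (hω : B / ε < Y ω) => ENNReal.ofReal_le_ofReal hω.le
    _ ≤ expNonneg μ Y / ENNReal.ofReal (B / ε) :=
        meas_ge_le_lintegral_div hY.ennreal_ofReal.aemeasurable (by simpa using hpos)
          ENNReal.ofReal_ne_top
    _ ≤ ENNReal.ofReal B / ENNReal.ofReal (B / ε) := by gcongr
    _ = ENNReal.ofReal ε := by
        rw [← ENNReal.ofReal_div_of_pos hpos]
        congr 1
        field_simp

/-! ### The error matrix of the model -/

theorem sum_fin_add_one (t : ℕ) (g : ℕ → ℝ) :
    ∑ s : Fin t, g ((s : ℕ) + 1) = ∑ s ∈ Finset.Icc 1 t, g s := by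
  rw [Fin.sum_univ_eq_sum_range (fun s => g (s + 1)) t, Finset.range_eq_Ico,
    Finset.sum_Ico_add' g 0 t 1]
  rfl

/-- The entry `f_s' Λ' e_u` of `F Λ' E'`. -/
noncomputable def crossTerm {Ω : Type*} {r : ℕ} (f : ℕ → Ω → Fin r → ℝ)
    (lam : ℕ → ℕ → Ω → Fin r → ℝ) (e : ℕ → ℕ → Ω → ℝ) (N s u : ℕ) (ω : Ω) : ℝ :=
  ∑ i ∈ Finset.Icc 1 N, (f s ω ⬝ᵥ lam N i ω) * e i u ω

/-- The entry `e_s' e_u` of `E E'`. -/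
noncomputable def idioTerm {Ω : Type*} (e : ℕ → ℕ → Ω → ℝ) (N s u : ℕ) (ω : Ω) : ℝ :=
  ∑ i ∈ Finset.Icc 1 N, e i s ω * e i u ω

/-- The squared Frobenius norm of `F_T Λ' E_T'`. -/
noncomputable def crossSum {Ω : Type*} {r : ℕ} (f : ℕ → Ω → Fin r → ℝ)
    (lam : ℕ → ℕ → Ω → Fin r → ℝ) (e : ℕ → ℕ → Ω → ℝ) (N T : ℕ) (ω : Ω) : ℝ :=
  ∑ s ∈ Finset.Icc 1 T, ∑ u ∈ Finset.Icc 1 T, crossTerm f lam e N s u ω ^ 2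

/-- The entry at `(s, u)` of `F Λ' E' + E Λ F' + E E'`. -/
noncomputable def errorTerm {Ω : Type*} {r : ℕ} (f : ℕ → Ω → Fin r → ℝ)
    (lam : ℕ → ℕ → Ω → Fin r → ℝ) (e : ℕ → ℕ → Ω → ℝ) (N s u : ℕ) (ω : Ω) : ℝ :=
  crossTerm f lam e N s u ω + crossTerm f lam e N u s ω + idioTerm e N s u ω

/-- The squared Frobenius norm of `F_T Λ' E_T' + E_T Λ F_T' + E_T E_T'`. -/
noncomputable def errorSum {Ω : Type*} {r : ℕ} (f : ℕ → Ω → Fin r → ℝ)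
    (lam : ℕ → ℕ → Ω → Fin r → ℝ) (e : ℕ → ℕ → Ω → ℝ) (N T : ℕ) (ω : Ω) : ℝ :=
  ∑ s ∈ Finset.Icc 1 T, ∑ u ∈ Finset.Icc 1 T, errorTerm f lam e N s u ω ^ 2

section Model

variable {Ω : Type*} {r : ℕ} {f : ℕ → Ω → Fin r → ℝ} {lam : ℕ → ℕ → Ω → Fin r → ℝ}
  {e : ℕ → ℕ → Ω → ℝ}

theorem factor_loading_idio_apply (N t : ℕ) (ω : Ω) (s u : Fin t) :
    (factorMat f t ω * (loadingMat lam N ω)ᵀ * (idioMat e N t ω)ᵀ) s u =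
      crossTerm f lam e N (s + 1) (u + 1) ω := by
  rw [crossTerm, ← sum_fin_add_one]
  simp [Matrix.mul_apply, factorMat, loadingMat, idioMat, dotProduct]

theorem idio_loading_factor_apply (N t : ℕ) (ω : Ω) (s u : Fin t) :
    (idioMat e N t ω * loadingMat lam N ω * (factorMat f t ω)ᵀ) s u =
      crossTerm f lam e N (u + 1) (s + 1) ω := by
  rw [← factor_loading_idio_apply, Matrix.mul_assoc (factorMat f t ω),
    ← Matrix.transpose_mul, ← Matrix.transpose_apply (_ * _) s u, Matrix.transpose_mul,
    Matrix.transpose_transpose]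

theorem idio_idio_apply (N t : ℕ) (ω : Ω) (s u : Fin t) :
    (idioMat e N t ω * (idioMat e N t ω)ᵀ) s u = idioTerm e N (s + 1) (u + 1) ω := by
  rw [idioTerm, ← sum_fin_add_one]
  simp [Matrix.mul_apply, idioMat]

theorem crossSum_mono {N t T : ℕ} (h : t ≤ T) (ω : Ω) :
    crossSum f lam e N t ω ≤ crossSum f lam e N T ω := by
  have hsub : Finset.Icc 1 t ⊆ Finset.Icc 1 T := Finset.Icc_subset_Icc_right h
  refine (Finset.sum_le_sum_of_subset_of_nonneg hsub fun _ _ _ => by positivity).trans ?_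
  exact Finset.sum_le_sum fun s _ =>
    Finset.sum_le_sum_of_subset_of_nonneg hsub fun _ _ _ => by positivity

theorem norm_factor_loading_idio_sq (N t : ℕ) (ω : Ω) :
    ‖factorMat f t ω * (loadingMat lam N ω)ᵀ * (idioMat e N t ω)ᵀ‖ ^ 2 =
      crossSum f lam e N t ω := by
  rw [frobenius_norm_sq_eq_sum, crossSum, ← sum_fin_add_one]
  refine Finset.sum_congr rfl fun s _ => ?_
  rw [← sum_fin_add_one]
  exact Finset.sum_congr rfl fun u _ => by rw [factor_loading_idio_apply]

theorem model_row_error_le {Fhat : (N t : ℕ) → Ω → Matrix (Fin t) (Fin r) ℝ} {N t : ℕ} {ω : Ω}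
    (ht : 0 < t) (h : IsPCFactors (dataMat f lam e N t ω) (Fhat N t ω)) {δ : ℝ} (hδ : 0 < δ)
    (hD : ∀ j, j < r → δ ≤ pcEigenvalue (dataMat f lam e N t ω) j) (s : Fin t) :
    ‖WithLp.toLp 2
        (Fhat N t ω s - modelRotation f lam e Fhat N t ω *ᵥ f ((s : ℕ) + 1) ω)‖ ^ 2 ≤
      r * t * (N * t * δ)⁻¹ ^ 2 *
        ∑ u ∈ Finset.Icc 1 t, errorTerm f lam e N ((s : ℕ) + 1) u ω ^ 2 := by
  have := IsPCFactors.row_error_le ht h hδ hD s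
  rw [norm_toLp_sq_eq_sum, ← sum_fin_add_one]
  refine this.trans (le_of_eq ?_)
  congr 1
  refine Finset.sum_congr rfl fun u _ => ?_
  rw [Matrix.add_apply, Matrix.add_apply, factor_loading_idio_apply, idio_loading_factor_apply,
    idio_idio_apply, errorTerm]

/-! ### Second moments of the error matrix. -/

variable [MeasurableSpace Ω]

theorem measurable_crossTerm (hf : ∀ t, Measurable (f t)) (hlam : ∀ N i, Measurable (lam N i))
    (he : ∀ i t, Measurable (e i t)) (N s u : ℕ) : Measurable (crossTerm f lam e N s u) := by
  unfold crossTerm dotProduct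
  fun_prop

theorem measurable_idioTerm (he : ∀ i t, Measurable (e i t)) (N s u : ℕ) :
    Measurable (idioTerm e N s u) := by
  unfold idioTerm
  fun_prop

theorem measurable_errorTerm (hf : ∀ t, Measurable (f t)) (hlam : ∀ N i, Measurable (lam N i))
    (he : ∀ i t, Measurable (e i t)) (N s u : ℕ) : Measurable (errorTerm f lam e N s u) :=
  ((measurable_crossTerm hf hlam he N s u).add (measurable_crossTerm hf hlam he N u s)).add
    (measurable_idioTerm he N s u)

variable {μ : Measure Ω}

theorem expNonneg_crossTerm_sq_le (hf : ∀ t, Measurable (f t))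
    (hlam : ∀ N i, Measurable (lam N i)) (he : ∀ i t, Measurable (e i t)) {b : ℝ} {M : ℝ≥0}
    {N s u : ℕ} (hN : 0 < N)
    (h : expNonneg μ (fun ω => ((N : ℝ) ^ (-b / 2) * crossTerm f lam e N s u ω) ^ 2) ≤ M) :
    expNonneg μ (fun ω => crossTerm f lam e N s u ω ^ 2) ≤
      ENNReal.ofReal ((N : ℝ) ^ b * M) := by
  have hN' : (0 : ℝ) < N := by exact_mod_cast hN
  have hm := measurable_crossTerm (r := r) hf hlam he N s u
  have key := expNonneg_const_mul_le (μ := μ) (a := M) ((hm.const_mul _).pow_const 2)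
    (Real.rpow_nonneg hN'.le b) (by simpa using h)
  refine (expNonneg_mono fun ω => le_of_eq ?_).trans key
  have hone : (N : ℝ) ^ b * ((N : ℝ) ^ (-b / 2)) ^ 2 = 1 := by
    rw [← Real.rpow_natCast _ 2, ← Real.rpow_mul hN'.le, ← Real.rpow_add hN',
      show b + -b / 2 * ((2 : ℕ) : ℝ) = 0 by push_cast; ring, Real.rpow_zero]
  rw [mul_pow, ← mul_assoc, hone, one_mul]

/-- Split `e_s'e_u` into `N^(1/2) ξ`, with `ξ` the normalized centred sum, plus its mean. The fourth
moment controls the square through `ξ² ≤ 1 + ξ⁴`, and Cauchy-Schwarz turns the squared mean into `N`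
times a sum of squared autocovariances, the form in which these are assumed summable. -/
theorem expNonneg_idioTerm_sq_le [IsProbabilityMeasure μ] (he : ∀ i t, Measurable (e i t))
    {M : ℝ≥0} {N s u : ℕ} (hN : 0 < N)
    (h : expNonneg μ (fun ω => ((N : ℝ) ^ (-(1 / 2) : ℝ) *
      ∑ i ∈ Finset.Icc 1 N, (e i s ω * e i u ω - ∫ ω', e i s ω' * e i u ω' ∂μ)) ^ 4) ≤ M) :
    expNonneg μ (fun ω => idioTerm e N s u ω ^ 2) ≤
      ENNReal.ofReal (2 * N * (1 + M) +
        2 * N * ∑ i ∈ Finset.Icc 1 N, (∫ ω', e i s ω' * e i u ω' ∂μ) ^ 2) := by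
  have hN' : (0 : ℝ) < N := by exact_mod_cast hN
  set γ : ℕ → ℝ := fun i => ∫ ω', e i s ω' * e i u ω' ∂μ with hγ
  set ξ : Ω → ℝ := fun ω => (N : ℝ) ^ (-(1 / 2) : ℝ) *
      ∑ i ∈ Finset.Icc 1 N, (e i s ω * e i u ω - γ i) with hξ
  have hξm : Measurable ξ := by
    rw [hξ]
    fun_prop
  have h1 : expNonneg μ (fun ω => 1 + ξ ω ^ 4) ≤ ENNReal.ofReal (1 + M) :=
    expNonneg_add_le measurable_const zero_le_one M.2 (expNonneg_const 1).le
      (h.trans_eq ENNReal.ofReal_coe_nnreal.symm)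
  have h2 := expNonneg_const_mul_le (μ := μ) (measurable_const.add (hξm.pow_const 4))
    (by positivity : (0 : ℝ) ≤ 2 * N) h1
  have h3 := expNonneg_add_le (μ := μ) ((measurable_const.add (hξm.pow_const 4)).const_mul _)
    (by positivity) (by positivity : 0 ≤ 2 * N * ∑ i ∈ Finset.Icc 1 N, γ i ^ 2) h2
    (expNonneg_const _).le
  refine (expNonneg_mono fun ω => ?_).trans h3
  have e1 : idioTerm e N s u ω = (N : ℝ) ^ (1 / 2 : ℝ) * ξ ω + ∑ i ∈ Finset.Icc 1 N, γ i := by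
    rw [hξ]
    simp only
    rw [← mul_assoc, ← Real.rpow_add hN', Finset.sum_sub_distrib]
    norm_num [idioTerm]
  have e2 : ((N : ℝ) ^ (1 / 2 : ℝ)) ^ 2 = N := by
    rw [← Real.sqrt_eq_rpow, Real.sq_sqrt hN'.le]
  have e3 : (∑ i ∈ Finset.Icc 1 N, γ i) ^ 2 ≤ N * ∑ i ∈ Finset.Icc 1 N, γ i ^ 2 := by
    simpa using sq_sum_le_card_mul_sum_sq (s := Finset.Icc 1 N) (f := γ)
  have e4 : ξ ω ^ 2 ≤ 1 + ξ ω ^ 4 := by nlinarith [sq_nonneg (ξ ω ^ 2 - 1), sq_nonneg (ξ ω)]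
  rw [e1]
  calc ((N : ℝ) ^ (1 / 2 : ℝ) * ξ ω + ∑ i ∈ Finset.Icc 1 N, γ i) ^ 2
      ≤ 2 * (((N : ℝ) ^ (1 / 2 : ℝ) * ξ ω) ^ 2 + (∑ i ∈ Finset.Icc 1 N, γ i) ^ 2) := add_sq_le
    _ ≤ 2 * (N * (1 + ξ ω ^ 4) + N * ∑ i ∈ Finset.Icc 1 N, γ i ^ 2) := by
        rw [mul_pow, e2]
        gcongr
    _ = _ := by
        simp only [Pi.add_apply]
        ring

theorem expNonneg_errorTerm_sq_le (hf : ∀ t, Measurable (f t))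
    (hlam : ∀ N i, Measurable (lam N i)) (he : ∀ i t, Measurable (e i t)) {N s u : ℕ} {A B : ℝ}
    (hA : 0 ≤ A) (hB : 0 ≤ B)
    (h1 : expNonneg μ (fun ω => crossTerm f lam e N s u ω ^ 2) ≤ ENNReal.ofReal A)
    (h2 : expNonneg μ (fun ω => crossTerm f lam e N u s ω ^ 2) ≤ ENNReal.ofReal A)
    (h3 : expNonneg μ (fun ω => idioTerm e N s u ω ^ 2) ≤ ENNReal.ofReal B) :
    expNonneg μ (fun ω => errorTerm f lam e N s u ω ^ 2) ≤ ENNReal.ofReal (3 * (A + A + B)) := by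
  have m1 := (measurable_crossTerm (r := r) hf hlam he N s u).pow_const 2
  have m2 := (measurable_crossTerm (r := r) hf hlam he N u s).pow_const 2
  have m3 := (measurable_idioTerm he N s u).pow_const 2
  have h := expNonneg_const_mul_le (μ := μ) ((m1.add m2).add m3) (by norm_num : (0 : ℝ) ≤ 3)
    (expNonneg_add_le (m1.add m2) (add_nonneg hA hA) hB (expNonneg_add_le m1 hA hA h1 h2) h3)
  refine (expNonneg_mono fun ω => ?_).trans h
  simp only [errorTerm, Pi.add_apply]
  set a := crossTerm f lam e N s u ω
  set b := crossTerm f lam e N u s ω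
  set d := idioTerm e N s u ω
  nlinarith [sq_nonneg (a - b), sq_nonneg (a - d), sq_nonneg (b - d)]

/-- There are `T²` entries with second moment at most `N^b M`; Markov's inequality does the rest.
This finer rate in `b`, rather than the one for the whole error matrix, is what the eigenvalue bound
uses. -/
theorem measure_crossSum_le (hf : ∀ t, Measurable (f t)) (hlam : ∀ N i, Measurable (lam N i))
    (he : ∀ i t, Measurable (e i t)) {b : ℝ}
    (h : ∃ M : ℝ≥0, ∀ N s t : ℕ, 1 ≤ s → 1 ≤ t →
      expNonneg μ (fun ω => ((N : ℝ) ^ (-b / 2) * crossTerm f lam e N s t ω) ^ 2) ≤ M) :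
    ∃ K : ℝ, 0 < K ∧ ∀ ε : ℝ, 0 < ε → ∀ N T : ℕ, 0 < N → 0 < T →
      μ {ω | K * ((T : ℝ) ^ 2 * (N : ℝ) ^ b) / ε < crossSum f lam e N T ω} ≤
        ENNReal.ofReal ε := by
  obtain ⟨M, hM⟩ := h
  refine ⟨M + 1, by positivity, fun ε hε N T hN hT => ?_⟩
  have hN' : (0 : ℝ) < N := by exact_mod_cast hN
  have hT' : (0 : ℝ) < T := by exact_mod_cast hT
  have hb : 0 < (N : ℝ) ^ b := Real.rpow_pos_of_pos hN' b
  have m : ∀ s u, Measurable fun ω => crossTerm f lam e N s u ω ^ 2 :=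
    fun s u => (measurable_crossTerm hf hlam he N s u).pow_const 2
  refine measure_lt_le_of_expNonneg_le (Finset.measurable_sum _ fun s _ =>
    Finset.measurable_sum _ fun u _ => m s u) (by positivity) hε ?_
  have key : expNonneg μ (crossSum f lam e N T) ≤
      ENNReal.ofReal (∑ _s ∈ Finset.Icc 1 T, ∑ _u ∈ Finset.Icc 1 T, (N : ℝ) ^ b * M) := by
    refine expNonneg_sum_le _ (fun s => Finset.measurable_sum _ fun u _ => m s u)
      (fun s ω => by positivity) (fun s _ => by positivity) fun s hs => ?_
    refine expNonneg_sum_le _ (m s) (fun u ω => by positivity) (fun u _ => by positivity)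
      fun u hu => ?_
    exact expNonneg_crossTerm_sq_le hf hlam he hN
      (hM N s u (Finset.mem_Icc.1 hs).1 (Finset.mem_Icc.1 hu).1)
  refine key.trans (ENNReal.ofReal_le_ofReal ?_)
  simp only [Finset.sum_const, Nat.card_Icc, nsmul_eq_mul, Nat.add_sub_cancel]
  have : 0 < (T : ℝ) ^ 2 * (N : ℝ) ^ b := by positivity
  nlinarith

/-- Cross terms contribute `T² N^b ≤ T² N`, the centred part of `EE'` contributes `T² N`, and the
squared autocovariances contribute `N · N · T`, since for each series their double sum over time is
only of order `T`. -/
theorem measure_errorSum_le [IsProbabilityMeasure μ] (hf : ∀ t, Measurable (f t))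
    (hlam : ∀ N i, Measurable (lam N i)) (he : ∀ i t, Measurable (e i t)) {b : ℝ} (hb : b ≤ 1)
    (h : ∃ M : ℝ≥0, ∀ N s t : ℕ, 1 ≤ s → 1 ≤ t →
      expNonneg μ (fun ω => ((N : ℝ) ^ (-b / 2) * crossTerm f lam e N s t ω) ^ 2) ≤ M)
    (hcross : ∃ M : ℝ≥0, ∀ N t s : ℕ, 1 ≤ t → 1 ≤ s →
      expNonneg μ (fun ω => ((N : ℝ) ^ (-(1 / 2) : ℝ) *
        ∑ i ∈ Finset.Icc 1 N, (e i t ω * e i s ω - ∫ ω', e i t ω' * e i s ω' ∂μ)) ^ 4) ≤ M)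
    (hsum : ∃ M : ℝ≥0, ∀ i T : ℕ, 1 ≤ i →
      (T : ℝ)⁻¹ * ∑ t ∈ Finset.Icc 1 T, ∑ s ∈ Finset.Icc 1 T,
        (∫ ω, e i t ω * e i s ω ∂μ) ^ 2 ≤ M) :
    ∃ K : ℝ, 0 < K ∧ ∀ ε : ℝ, 0 < ε → ∀ N T : ℕ, 0 < N → 0 < T →
      μ {ω | K * ((T : ℝ) ^ 2 * N + (N : ℝ) ^ 2 * T) / ε < errorSum f lam e N T ω} ≤
        ENNReal.ofReal ε := by
  obtain ⟨M₁, hM₁⟩ := h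
  obtain ⟨M₂, hM₂⟩ := hcross
  obtain ⟨M₃, hM₃⟩ := hsum
  refine ⟨6 * (M₁ + M₂ + M₃ + 1), by positivity, fun ε hε N T hN hT => ?_⟩
  have hN' : (0 : ℝ) < N := by exact_mod_cast hN
  have hT' : (0 : ℝ) < T := by exact_mod_cast hT
  have hNb0 : 0 < (N : ℝ) ^ b := Real.rpow_pos_of_pos hN' b
  have hNb : (N : ℝ) ^ b ≤ N := by
    simpa using Real.rpow_le_rpow_of_exponent_le (by exact_mod_cast hN : (1 : ℝ) ≤ N) hb
  have m : ∀ s u, Measurable fun ω => errorTerm f lam e N s u ω ^ 2 :=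
    fun s u => (measurable_errorTerm hf hlam he N s u).pow_const 2
  refine measure_lt_le_of_expNonneg_le (Finset.measurable_sum _ fun s _ =>
    Finset.measurable_sum _ fun u _ => m s u) (by positivity) hε ?_
  set γ : ℕ → ℕ → ℕ → ℝ := fun i s u => ∫ ω, e i s ω * e i u ω ∂μ with hγ
  set B : ℕ → ℕ → ℝ := fun s u => 3 * ((N : ℝ) ^ b * M₁ + (N : ℝ) ^ b * M₁ +
    (2 * N * (1 + M₂) + 2 * N * ∑ i ∈ Finset.Icc 1 N, γ i s u ^ 2)) with hBdef
  have key : expNonneg μ (errorSum f lam e N T) ≤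
      ENNReal.ofReal (∑ s ∈ Finset.Icc 1 T, ∑ u ∈ Finset.Icc 1 T, B s u) := by
    refine expNonneg_sum_le _ (fun s => Finset.measurable_sum _ fun u _ => m s u)
      (fun s ω => by positivity) (fun s _ => by positivity) fun s hs => ?_
    refine expNonneg_sum_le _ (m s) (fun u ω => by positivity) (fun u _ => by positivity)
      fun u hu => ?_
    have hs1 := (Finset.mem_Icc.1 hs).1
    have hu1 := (Finset.mem_Icc.1 hu).1
    exact expNonneg_errorTerm_sq_le hf hlam he (by positivity) (by positivity)
      (expNonneg_crossTerm_sq_le hf hlam he hN (hM₁ N s u hs1 hu1))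
      (expNonneg_crossTerm_sq_le hf hlam he hN (hM₁ N u s hu1 hs1))
      (expNonneg_idioTerm_sq_le he hN (hM₂ N s u hs1 hu1))
  refine key.trans (ENNReal.ofReal_le_ofReal ?_)
  have hγsum : ∑ s ∈ Finset.Icc 1 T, ∑ u ∈ Finset.Icc 1 T, ∑ i ∈ Finset.Icc 1 N, γ i s u ^ 2 ≤
      N * (T * M₃) := by
    have hswap : ∑ s ∈ Finset.Icc 1 T, ∑ u ∈ Finset.Icc 1 T, ∑ i ∈ Finset.Icc 1 N, γ i s u ^ 2 =
        ∑ i ∈ Finset.Icc 1 N, ∑ s ∈ Finset.Icc 1 T, ∑ u ∈ Finset.Icc 1 T, γ i s u ^ 2 := by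
      rw [Finset.sum_comm]
      simp_rw [Finset.sum_comm (s := Finset.Icc 1 T) (t := Finset.Icc 1 N)]
      exact Finset.sum_congr rfl fun i _ => Finset.sum_comm
    rw [hswap]
    calc _ ≤ ∑ _i ∈ Finset.Icc 1 N, (T * M₃ : ℝ) := by
          refine Finset.sum_le_sum fun i hi => ?_
          have := hM₃ i T (Finset.mem_Icc.1 hi).1
          rwa [inv_mul_le_iff₀ hT'] at this
      _ = _ := by simp
  have hBsum : ∑ s ∈ Finset.Icc 1 T, ∑ u ∈ Finset.Icc 1 T, B s u =
      (T : ℝ) ^ 2 * (6 * ((N : ℝ) ^ b * M₁) + 6 * N * (1 + M₂)) +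
      6 * N * ∑ s ∈ Finset.Icc 1 T, ∑ u ∈ Finset.Icc 1 T, ∑ i ∈ Finset.Icc 1 N, γ i s u ^ 2 := by
    simp only [hBdef, mul_add, Finset.sum_add_distrib, ← Finset.mul_sum, Finset.sum_const,
      Nat.card_Icc, nsmul_eq_mul, Nat.add_sub_cancel]
    ring
  rw [hBsum]
  have g1 : (N : ℝ) ^ b * M₁ ≤ N * M₁ := mul_le_mul_of_nonneg_right hNb M₁.2
  have g2 : (0 : ℝ) ≤ M₁ := M₁.2
  have g3 : (0 : ℝ) ≤ M₂ := M₂.2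
  have g4 : (0 : ℝ) ≤ M₃ := M₃.2
  calc _ ≤ (T : ℝ) ^ 2 * (6 * (N * M₁) + 6 * N * (1 + M₂)) + 6 * N * (N * (T * M₃)) := by gcongr
    _ = 6 * (M₁ + 1 + M₂) * ((T : ℝ) ^ 2 * N) + 6 * M₃ * ((N : ℝ) ^ 2 * T) := by ring
    _ ≤ 6 * (M₁ + M₂ + M₃ + 1) * ((T : ℝ) ^ 2 * N) +
        6 * (M₁ + M₂ + M₃ + 1) * ((N : ℝ) ^ 2 * T) := by
        have k1 : 6 * ((M₁ : ℝ) + 1 + M₂) ≤ 6 * (M₁ + M₂ + M₃ + 1) := by linarith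
        have k2 : 6 * (M₃ : ℝ) ≤ 6 * (M₁ + M₂ + M₃ + 1) := by linarith
        exact add_le_add (mul_le_mul_of_nonneg_right k1 (by positivity))
          (mul_le_mul_of_nonneg_right k2 (by positivity))
    _ = _ := by ring

end Model

/-! ### Stochastic order calculus -/

theorem IsBigOp.mono_rate {ι Ω : Type*} [MeasurableSpace Ω] {μ : Measure Ω} {l : Filter ι}
    {X : ι → Ω → ℝ} {a b : ι → ℝ} (h : IsBigOp μ l X a) (hab : ∀ᶠ i in l, a i ≤ b i) :
    IsBigOp μ l X b := by
  intro ε hε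
  obtain ⟨C, hC, hX⟩ := h ε hε
  refine ⟨C, hC, ?_⟩
  filter_upwards [hX, hab] with i hi hi'
  exact (measure_mono fun ω (hω : C * b i < |X i ω|) =>
    (mul_le_mul_of_nonneg_left hi' hC.le).trans_lt hω).trans hi

theorem tendsto_zero_of_le_ofReal {ι : Type*} {l : Filter ι} {g : ι → ℝ≥0∞}
    (h : ∀ ε : ℝ, 0 < ε → ∀ᶠ i in l, g i ≤ ENNReal.ofReal ε) : Tendsto g l (𝓝 0) := by
  rw [ENNReal.tendsto_nhds_zero]
  intro ε hε
  obtain ⟨x, -, hx0, hxε⟩ := ENNReal.lt_iff_exists_real_btwn.1 hε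
  filter_upwards [h x (by simpa using hx0)] with i hi
  exact hi.trans hxε.le

theorem IsBigOp.tendstoInMeasure {ι Ω : Type*} [MeasurableSpace Ω] {μ : Measure Ω} {l : Filter ι}
    {X : ι → Ω → ℝ} {a : ι → ℝ} (h : IsBigOp μ l X a) (ha : Tendsto a l (𝓝 0)) :
    TendstoInMeasure μ X l (fun _ => 0) := by
  rw [tendstoInMeasure_iff_dist]
  refine fun η hη => tendsto_zero_of_le_ofReal fun ε hε => ?_
  obtain ⟨C, hC, hX⟩ := h ε hε
  have hCa : Tendsto (fun i => C * a i) l (𝓝 0) := by simpa using ha.const_mul C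
  filter_upwards [hX, hCa.eventually_lt_const hη] with i hi hi'
  refine (measure_mono fun ω (hω : η ≤ dist (X i ω) 0) => ?_).trans hi
  rw [Real.dist_eq, sub_zero] at hω
  exact hi'.trans_le hω

/-- Good events are handled through their complements, so that monotonicity and subadditivity of
outer measure suffice and no measurability of the events has to be shown. -/
theorem measure_not_mono {Ω : Type*} [MeasurableSpace Ω] {μ : Measure Ω} {P Q : Ω → Prop}
    {c : ℝ≥0∞} (h : ∀ ω, P ω → Q ω) (hP : μ {ω | ¬ P ω} ≤ c) : μ {ω | ¬ Q ω} ≤ c :=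
  (measure_mono fun ω (hω : ¬ Q ω) => mt (h ω) hω).trans hP

theorem measure_not_and_le {Ω : Type*} [MeasurableSpace Ω] {μ : Measure Ω} {P Q : Ω → Prop}
    {a b : ℝ} (ha : 0 ≤ a) (hb : 0 ≤ b) (hP : μ {ω | ¬ P ω} ≤ ENNReal.ofReal a)
    (hQ : μ {ω | ¬ Q ω} ≤ ENNReal.ofReal b) :
    μ {ω | ¬ (P ω ∧ Q ω)} ≤ ENNReal.ofReal (a + b) := by
  rw [ENNReal.ofReal_add ha hb]
  refine (measure_mono fun ω hω => ?_).trans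
    ((measure_union_le {ω | ¬ P ω} {ω | ¬ Q ω}).trans (add_le_add hP hQ))
  exact not_and_or.1 hω

/-! ### Gram matrices of the loadings and of the factors -/

/-- Once `‖G - S‖` falls below `c/2`, the perturbation costs at most half of the lower bound `c` of
`S`. -/
theorem IsBigOp.eventually_quadraticForm_ge {ι Ω n : Type*} [Fintype n] [MeasurableSpace Ω]
    {μ : Measure Ω} {l : Filter ι} {G : ι → Ω → Matrix n n ℝ} {S : Matrix n n ℝ} {ρ : ι → ℝ}
    (h : IsBigOp μ l (fun i ω => ‖G i ω - S‖) ρ) (hρ : Tendsto ρ l (𝓝 0)) {c : ℝ} (hc : 0 < c)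
    (hS : ∀ w, c * (w ⬝ᵥ w) ≤ w ⬝ᵥ S *ᵥ w) {ε : ℝ} (hε : 0 < ε) :
    ∀ᶠ i in l, μ {ω | ¬ ∀ w, c / 2 * (w ⬝ᵥ w) ≤ w ⬝ᵥ G i ω *ᵥ w} ≤ ENNReal.ofReal ε := by
  obtain ⟨C, hC, hX⟩ := h ε hε
  have hCρ : Tendsto (fun i => C * ρ i) l (𝓝 0) := by simpa using hρ.const_mul C
  filter_upwards [hX, hCρ.eventually_lt_const (half_pos hc)] with i hi hi'
  refine (measure_mono fun ω hω => ?_).trans hi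
  rw [Set.mem_ofPred_eq, abs_of_nonneg (norm_nonneg _)]
  by_contra hcon
  refine hω fun w => ?_
  have h1 := (not_lt.1 hcon).trans hi'.le
  have h2 := abs_quadraticForm_le (G i ω - S) w
  have h3 := mul_le_mul_of_nonneg_right h1 (dotProduct_self_nonneg_real w)
  have h4 := neg_abs_le (w ⬝ᵥ (G i ω - S) *ᵥ w)
  rw [Matrix.sub_mulVec, dotProduct_sub] at h2 h4
  linarith [hS w]

theorem quadraticForm_gram {m n : Type*} [Fintype m] [Fintype n] (L : Matrix m n ℝ) (w : n → ℝ) :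
    w ⬝ᵥ (Lᵀ * L) *ᵥ w = (L *ᵥ w) ⬝ᵥ (L *ᵥ w) := by
  rw [← Matrix.mulVec_mulVec, Matrix.dotProduct_mulVec, Matrix.vecMul_transpose]

theorem tendsto_fst_of_le {l : Filter (ℕ × ℕ)} (hl : l ≤ atTop ×ˢ atTop) :
    Tendsto (fun p : ℕ × ℕ => (p.1 : ℝ)) l atTop :=
  tendsto_natCast_atTop_atTop.comp (tendsto_fst.mono_left hl)

theorem tendsto_snd_of_le {l : Filter (ℕ × ℕ)} (hl : l ≤ atTop ×ˢ atTop) :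
    Tendsto (fun p : ℕ × ℕ => p.2) l atTop :=
  tendsto_snd.mono_left hl

theorem tendsto_snd_cast_of_le {l : Filter (ℕ × ℕ)} (hl : l ≤ atTop ×ˢ atTop) :
    Tendsto (fun p : ℕ × ℕ => (p.2 : ℝ)) l atTop :=
  tendsto_natCast_atTop_atTop.comp (tendsto_snd_of_le hl)

theorem eventually_le_splitPoint {π₀ : ℝ} (hπ : 0 < π₀) :
    ∀ᶠ T : ℕ in atTop, π₀ / 2 * T ≤ splitPoint π₀ T := by
  filter_upwards [tendsto_natCast_atTop_atTop.eventually_ge_atTop (2 / π₀)] with T hT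
  have h1 := Nat.lt_floor_add_one ((T : ℝ) * π₀)
  rw [div_le_iff₀ hπ] at hT
  unfold splitPoint
  linarith

theorem tendsto_splitPoint {π₀ : ℝ} (hπ : 0 < π₀) : Tendsto (splitPoint π₀) atTop atTop :=
  tendsto_nat_floor_atTop.comp (tendsto_natCast_atTop_atTop.atTop_mul_const hπ)

theorem splitPoint_le {π₀ : ℝ} (hπ : π₀ < 1) (T : ℕ) : splitPoint π₀ T ≤ T :=
  Nat.floor_le_of_le (mul_le_of_le_one_right T.cast_nonneg hπ.le)

section Loadings

variable {Ω : Type*} [MeasurableSpace Ω] {μ : Measure Ω} {l : Filter (ℕ × ℕ)} {r : ℕ}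
  {f : ℕ → Ω → Fin r → ℝ} {e : ℕ → ℕ → Ω → ℝ} {lam : ℕ → ℕ → Ω → Fin r → ℝ}

/-- With probability tending to one, `Λ'Λ ≥ c N^a`. -/
def LoadingsAtLeast (μ : Measure Ω) (l : Filter (ℕ × ℕ)) (lam : ℕ → ℕ → Ω → Fin r → ℝ)
    (c a : ℝ) : Prop :=
  ∀ ε : ℝ, 0 < ε → ∀ᶠ p in l, μ {ω | ¬ ∀ w, c * (p.1 : ℝ) ^ a * (w ⬝ᵥ w) ≤
    (loadingMat lam p.1 ω *ᵥ w) ⬝ᵥ (loadingMat lam p.1 ω *ᵥ w)} ≤ ENNReal.ofReal ε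

theorem HomogeneousLoadings.loadingsAtLeast (hl : l ≤ atTop ×ˢ atTop) {α : ℝ} (hα : 0 < α)
    (h : HomogeneousLoadings μ l f e lam α) : ∃ c, 0 < c ∧ LoadingsAtLeast μ l lam c α := by
  obtain ⟨S, hS, hG⟩ := h.gram
  obtain ⟨c, hc, hcS⟩ := hS.exists_pos_mul_le
  refine ⟨c / 2, half_pos hc, fun ε hε => ?_⟩
  have hρ : Tendsto (fun p : ℕ × ℕ => (p.1 : ℝ) ^ (-α / 2)) l (𝓝 0) := by
    rw [neg_div]
    exact (tendsto_rpow_neg_atTop (half_pos hα)).comp (tendsto_fst_of_le hl)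
  filter_upwards [hG.eventually_quadraticForm_ge hρ hc hcS hε,
    (tendsto_fst_of_le hl).eventually_gt_atTop 0] with p hp hN
  refine measure_not_mono (fun ω hcon w => ?_) hp
  have h1 := hcon w
  rw [Matrix.smul_mulVec, dotProduct_smul, quadraticForm_gram, smul_eq_mul,
    Real.rpow_neg hN.le] at h1
  have hNα := Real.rpow_pos_of_pos hN α
  rw [← div_eq_inv_mul, le_div_iff₀ hNα] at h1
  linarith

/-- `Λ'Λ = B (B⁻¹Λ'ΛB⁻¹) B` is at least `c/2` times `B²`, and `B² ≥ N^a` because `N ≥ 1` and `a`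
bounds all exponents from below. -/
theorem HeterogeneousLoadings.loadingsAtLeast (hl : l ≤ atTop ×ˢ atTop) {α : Fin r → ℝ} {a : ℝ}
    (ha : 0 < a) (hα : ∀ j, a ≤ α j) (h : HeterogeneousLoadings μ l f e lam α a) :
    ∃ c, 0 < c ∧ LoadingsAtLeast μ l lam c a := by
  obtain ⟨S, hS, hG⟩ := h.gram
  obtain ⟨c, hc, hcS⟩ := hS.exists_pos_mul_le
  refine ⟨c / 2, half_pos hc, fun ε hε => ?_⟩
  have hρ : Tendsto (fun p : ℕ × ℕ => (p.1 : ℝ) ^ (-a / 2)) l (𝓝 0) := by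
    rw [neg_div]
    exact (tendsto_rpow_neg_atTop (half_pos ha)).comp (tendsto_fst_of_le hl)
  filter_upwards [hG.eventually_quadraticForm_ge hρ hc hcS hε,
    (tendsto_fst_of_le hl).eventually_ge_atTop 1] with p hp hN
  have hN0 : (0 : ℝ) < p.1 := one_pos.trans_le hN
  refine measure_not_mono (fun ω hcon w => ?_) hp
  set B := strengthMat α p.1 with hB
  set L := loadingMat lam p.1 ω
  have hunit : IsUnit B.det := by
    rw [hB, strengthMat, Matrix.det_diagonal, isUnit_iff_ne_zero]
    exact Finset.prod_ne_zero_iff.2 fun j _ => (Real.rpow_pos_of_pos hN0 _).ne'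
  have hBt : Bᵀ = B := Matrix.diagonal_transpose _
  have h1 := hcon (B *ᵥ w)
  have h2 : (B *ᵥ w) ⬝ᵥ (B⁻¹ * (Lᵀ * L) * B⁻¹) *ᵥ (B *ᵥ w) = (L *ᵥ w) ⬝ᵥ (L *ᵥ w) := by
    have hBB : B⁻¹ * (Lᵀ * L) * B⁻¹ = (L * B⁻¹)ᵀ * (L * B⁻¹) := by
      rw [Matrix.transpose_mul, Matrix.transpose_nonsing_inv, hBt]
      simp only [Matrix.mul_assoc]
    rw [hBB, quadraticForm_gram, Matrix.mulVec_mulVec, Matrix.mul_assoc,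
      Matrix.nonsing_inv_mul _ hunit, Matrix.mul_one]
  have h3 : (p.1 : ℝ) ^ a * (w ⬝ᵥ w) ≤ (B *ᵥ w) ⬝ᵥ (B *ᵥ w) := by
    rw [dotProduct_self_eq_sum_sq, dotProduct_self_eq_sum_sq, Finset.mul_sum]
    refine Finset.sum_le_sum fun j _ => ?_
    rw [hB, strengthMat, Matrix.mulVec_diagonal, mul_pow, ← Real.rpow_natCast (_ ^ (α j / 2)) 2,
      ← Real.rpow_mul hN0.le]
    refine mul_le_mul_of_nonneg_right (Real.rpow_le_rpow_of_exponent_le hN ?_) (sq_nonneg _)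
    push_cast
    linarith [hα j]
  rw [h2] at h1
  calc c / 2 * (p.1 : ℝ) ^ a * (w ⬝ᵥ w) = c / 2 * ((p.1 : ℝ) ^ a * (w ⬝ᵥ w)) := by ring
    _ ≤ c / 2 * ((B *ᵥ w) ⬝ᵥ (B *ᵥ w)) := by gcongr
    _ ≤ _ := h1

/-- The factors `B_N` and `B_N⁻¹` cancel in the inner product, leaving the homogeneous form of the
condition with exponent `b = 1`. For `N = 0`, where `B_N` may be singular, both sums are empty. -/
theorem HeterogeneousLoadings.crossTerm_bound {α : Fin r → ℝ} {a : ℝ}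
    (h : HeterogeneousLoadings μ l f e lam α a) :
    ∃ M : ℝ≥0, ∀ N s t : ℕ, 1 ≤ s → 1 ≤ t →
      expNonneg μ (fun ω => ((N : ℝ) ^ (-1 / 2 : ℝ) * crossTerm f lam e N s t ω) ^ 2) ≤ M := by
  obtain ⟨M, hM⟩ := h.cross
  refine ⟨M, fun N s t hs ht => (expNonneg_mono fun ω => le_of_eq ?_).trans (hM N s t hs ht)⟩
  congr 1
  rw [crossTerm, Finset.mul_sum]
  refine Finset.sum_congr rfl fun i hi => ?_
  have hN0 : (0 : ℝ) < N := by
    have := Finset.mem_Icc.1 hi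
    exact_mod_cast this.1.trans this.2
  have hunit : IsUnit (strengthMat α N).det := by
    rw [strengthMat, Matrix.det_diagonal, isUnit_iff_ne_zero]
    exact Finset.prod_ne_zero_iff.2 fun j _ => (Real.rpow_pos_of_pos hN0 _).ne'
  have hBt : (strengthMat α N)ᵀ = strengthMat α N := Matrix.diagonal_transpose _
  have : (strengthMat α N *ᵥ f s ω) ⬝ᵥ ((strengthMat α N)⁻¹ *ᵥ lam N i ω) =
      f s ω ⬝ᵥ lam N i ω := by
    rw [Matrix.dotProduct_mulVec, ← Matrix.mulVec_transpose, Matrix.transpose_nonsing_inv, hBt,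
      Matrix.mulVec_mulVec, Matrix.nonsing_inv_mul _ hunit, Matrix.one_mulVec]
  rw [smul_dotProduct, this, smul_eq_mul, neg_div]
  ring

omit [MeasurableSpace Ω] in
theorem factorMat_mulVec_dotProduct_self (t : ℕ) (ω : Ω) (a : Fin r → ℝ) :
    (factorMat f t ω *ᵥ a) ⬝ᵥ (factorMat f t ω *ᵥ a) =
      t * (a ⬝ᵥ a) + a ⬝ᵥ (∑ s ∈ Finset.Icc 1 t,
        (Matrix.vecMulVec (f s ω) (f s ω) - (1 : Matrix (Fin r) (Fin r) ℝ))) *ᵥ a := by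
  have h1 : (factorMat f t ω *ᵥ a) ⬝ᵥ (factorMat f t ω *ᵥ a) =
      ∑ s ∈ Finset.Icc 1 t, (f s ω ⬝ᵥ a) ^ 2 := by
    rw [dotProduct_self_eq_sum_sq, ← sum_fin_add_one]
    rfl
  rw [h1, Matrix.sum_mulVec, dotProduct_sum]
  have h2 : ∀ s ∈ Finset.Icc 1 t, a ⬝ᵥ (Matrix.vecMulVec (f s ω) (f s ω) -
      (1 : Matrix (Fin r) (Fin r) ℝ)) *ᵥ a = (f s ω ⬝ᵥ a) ^ 2 - a ⬝ᵥ a := by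
    intro s _
    rw [Matrix.sub_mulVec, Matrix.one_mulVec, dotProduct_sub, Matrix.vecMulVec_mulVec,
      dotProduct_smul, dotProduct_comm a (f s ω)]
    simp [sq]
  rw [Finset.sum_congr rfl h2, Finset.sum_sub_distrib]
  simp

/-- `F'F` is `t I` plus the partial sum of `f_s f_s' - I`, whose norm is uniformly `O_p(T^(1/2))`,
hence negligible against `t ≥ k₀`, which is of order `T`. -/
theorem FactorIdioAssumptions.factor_gram_ge (hl : l ≤ atTop ×ˢ atTop) {π₀ : ℝ} (hπ : 0 < π₀)
    (h : FactorIdioAssumptions μ l π₀ f e) {ε : ℝ} (hε : 0 < ε) :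
    ∀ᶠ p in l, μ {ω | ¬ ∀ t ∈ Finset.Icc (splitPoint π₀ p.2) (p.2 - 1), ∀ a,
      (t : ℝ) / 2 * (a ⬝ᵥ a) ≤ (factorMat f t ω *ᵥ a) ⬝ᵥ (factorMat f t ω *ᵥ a)} ≤
      ENNReal.ofReal ε := by
  obtain ⟨C, hC, hX⟩ := h.factor_cov ε hε
  have hρ : Tendsto (fun p : ℕ × ℕ => C * (p.2 : ℝ) ^ (-(1 / 2) : ℝ)) l (𝓝 0) := by
    simpa using ((tendsto_rpow_neg_atTop (by norm_num : (0 : ℝ) < 1 / 2)).comp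
      (tendsto_snd_cast_of_le hl)).const_mul C
  filter_upwards [hX, hρ.eventually_lt_const (by positivity : 0 < π₀ / 4),
    (tendsto_snd_of_le hl).eventually (eventually_le_splitPoint hπ),
    (tendsto_snd_cast_of_le hl).eventually_gt_atTop 0] with p hp hp1 hp2 hp3
  refine (measure_mono fun ω hω => ?_).trans hp
  rw [Set.mem_ofPred_eq]
  by_contra hcon
  refine hω fun t ht a => ?_
  rw [not_lt] at hcon
  set g : ↥(Finset.Icc (splitPoint π₀ p.2) (p.2 - 1)) → ℝ := fun t =>
      ‖(p.2 : ℝ)⁻¹ • ∑ s ∈ Finset.Icc 1 (t : ℕ),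
        (Matrix.vecMulVec (f s ω) (f s ω) - (1 : Matrix (Fin r) (Fin r) ℝ))‖ with hg
  have h1 : g ⟨t, ht⟩ ≤ π₀ / 4 :=
    ((le_ciSup (Set.finite_range g).bddAbove ⟨t, ht⟩).trans (le_abs_self _)).trans
      (hcon.trans hp1.le)
  simp only [hg] at h1
  rw [norm_smul, norm_inv, Real.norm_of_nonneg hp3.le, inv_mul_le_iff₀ hp3] at h1
  rw [factorMat_mulVec_dotProduct_self]
  set D := ∑ s ∈ Finset.Icc 1 t,
        (Matrix.vecMulVec (f s ω) (f s ω) - (1 : Matrix (Fin r) (Fin r) ℝ))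
  have h2 := abs_quadraticForm_le D a
  have h3 := neg_abs_le (a ⬝ᵥ D *ᵥ a)
  have ht1 : (splitPoint π₀ p.2 : ℝ) ≤ t := by exact_mod_cast (Finset.mem_Icc.1 ht).1
  -- The deviation is at most `(π₀/4) T`, and `t ≥ k₀ ≥ (π₀/2) T`.
  have h4 : ‖D‖ ≤ t / 2 := by linarith
  have h5 := mul_le_mul_of_nonneg_right h4 (dotProduct_self_nonneg_real a)
  linarith

/-! ### The event on which the deterministic bounds apply -/

/-- The `r` largest eigenvalues are at least `δ`, and the error matrix has squared norm at
most `K`. -/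
structure WellBehaved (π₀ : ℝ) (f : ℕ → Ω → Fin r → ℝ) (lam : ℕ → ℕ → Ω → Fin r → ℝ)
    (e : ℕ → ℕ → Ω → ℝ) (δ K : ℝ) (N T : ℕ) (ω : Ω) : Prop where
  eigenvalue_ge : ∀ t ∈ Finset.Icc (splitPoint π₀ T) (T - 1), ∀ j, j < r →
    δ ≤ pcEigenvalue (dataMat f lam e N t ω) j
  errorSum_le : errorSum f lam e N T ω ≤ K

omit [MeasurableSpace Ω] in
-- With `τ = t/2` and `κ = c N^a`, the allowance `η ≤ κ t/8` leaves `κτ - 2η ≥ c N^a t/4`; division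
-- by `N t` gives the bound. The cross term is controlled at the final date `T`, hence for all `t ≤
-- T`.
theorem le_pcEigenvalue_dataMat {N T t : ℕ} {ω : Ω} (hN : 0 < N) (ht : 0 < t) (hrt : r ≤ t)
    (htT : t ≤ T) {c a η : ℝ} (hc : 0 < c) (hη : 0 ≤ η)
    (hF : ∀ w, (t : ℝ) / 2 * (w ⬝ᵥ w) ≤ (factorMat f t ω *ᵥ w) ⬝ᵥ (factorMat f t ω *ᵥ w))
    (hL : ∀ w, c * (N : ℝ) ^ a * (w ⬝ᵥ w) ≤
      (loadingMat lam N ω *ᵥ w) ⬝ᵥ (loadingMat lam N ω *ᵥ w))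
    (hcross : crossSum f lam e N T ω ≤ η ^ 2) (hηt : η ≤ c * (N : ℝ) ^ a * t / 8)
    {j : ℕ} (hj : j < r) :
    c / 4 * (N : ℝ) ^ (a - 1) ≤ pcEigenvalue (dataMat f lam e N t ω) j := by
  have hN' : (0 : ℝ) < N := by exact_mod_cast hN
  have ht' : (0 : ℝ) < t := by exact_mod_cast ht
  have hnorm : ‖factorMat f t ω * (loadingMat lam N ω)ᵀ * (idioMat e N t ω)ᵀ‖ ≤ η := by
    refine le_of_sq_le_sq ?_ hη
    rw [norm_factor_loading_idio_sq]
    exact (crossSum_mono htT ω).trans hcross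
  refine le_trans ?_ (le_pcEigenvalue ht hN hrt _ _ _ (by positivity) (by positivity) hF hL
    hnorm hj)
  rw [Real.rpow_sub_one hN'.ne', le_inv_mul_iff₀ (by positivity)]
  have : (N : ℝ) * t * (c / 4 * ((N : ℝ) ^ a / N)) = c * (N : ℝ) ^ a * t / 4 := by
    field_simp
  rw [this]
  linarith

/-- Four events suffice, each failing with probability at most `ε/4`: `Λ'Λ` large, `F'F` large for
all `t`, cross sum small, error sum small. None of them has to be repeated over `t`. -/
theorem FactorIdioAssumptions.wellBehaved [IsProbabilityMeasure μ] (hl : l ≤ atTop ×ˢ atTop)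
    {π₀ : ℝ} (hπ : 0 < π₀) (hlam : ∀ N i, Measurable (lam N i))
    (h : FactorIdioAssumptions μ l π₀ f e) {c a b : ℝ} (hc : 0 < c)
    (hL : LoadingsAtLeast μ l lam c a) (hb : b ≤ 1) (hba : b < 2 * a)
    (hcross : ∃ M : ℝ≥0, ∀ N s t : ℕ, 1 ≤ s → 1 ≤ t →
      expNonneg μ (fun ω => ((N : ℝ) ^ (-b / 2) * crossTerm f lam e N s t ω) ^ 2) ≤ M)
    {ε : ℝ} (hε : 0 < ε) :
    ∃ K : ℝ, 0 < K ∧ ∀ᶠ p in l, μ {ω | ¬ WellBehaved π₀ f lam e (c / 4 * (p.1 : ℝ) ^ (a - 1))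
      (K * ((p.2 : ℝ) ^ 2 * p.1 + (p.1 : ℝ) ^ 2 * p.2)) p.1 p.2 ω} ≤ ENNReal.ofReal ε := by
  obtain ⟨K₁, hK₁, hcrossSum⟩ := measure_crossSum_le h.measurable_f hlam h.measurable_e hcross
  obtain ⟨K₂, hK₂, herrorSum⟩ := measure_errorSum_le h.measurable_f hlam h.measurable_e hb hcross
    h.idio_cross h.idio_summable
  have hε4 : 0 < ε / 4 := by positivity
  refine ⟨K₂ / (ε / 4), by positivity, ?_⟩
  set κ := √(K₁ / (ε / 4)) with hκ
  -- This is the ratio of the cross-term norm `κ T N^(b/2)` to `N^a T`; it vanishes because `b <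
  -- 2a`.
  have hρ : Tendsto (fun p : ℕ × ℕ => κ * (p.1 : ℝ) ^ (-(a - b / 2))) l (𝓝 0) := by
    simpa using ((tendsto_rpow_neg_atTop (by linarith : 0 < a - b / 2)).comp
      (tendsto_fst_of_le hl)).const_mul κ
  filter_upwards [hL _ hε4, h.factor_gram_ge hl hπ hε4,
    hρ.eventually_lt_const (by positivity : 0 < c * π₀ / 16),
    (tendsto_snd_of_le hl).eventually (eventually_le_splitPoint hπ),
    -- The bound `r + 1` yields both `t ≥ r`, needed for `r` eigenvalues to exist, and `t > 0`, even
    -- if `r = 0`.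
    (tendsto_snd_of_le hl).eventually ((tendsto_splitPoint hπ).eventually_ge_atTop (r + 1)),
    (tendsto_snd_cast_of_le hl).eventually_gt_atTop 0,
    (tendsto_fst_of_le hl).eventually_gt_atTop 0] with p hLp hFp hηp hk hkr hT hN
  have hT' : 0 < p.2 := by exact_mod_cast hT
  have hN' : 0 < p.1 := by exact_mod_cast hN
  have hA := hcrossSum (ε / 4) hε4 p.1 p.2 hN' hT'
  have hB := herrorSum (ε / 4) hε4 p.1 p.2 hN' hT'
  simp only [← not_le] at hA hB
  have hall := measure_not_and_le (by positivity) (by positivity)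
    (measure_not_and_le hε4.le hε4.le hLp hFp) (measure_not_and_le hε4.le hε4.le hA hB)
  rw [show ε / 4 + ε / 4 + (ε / 4 + ε / 4) = ε by ring] at hall
  refine measure_not_mono (fun ω hcon => ?_) hall
  obtain ⟨⟨hLω, hFω⟩, hAω, hBω⟩ := hcon
  refine ⟨fun t ht j hj => ?_, by rwa [div_mul_eq_mul_div]⟩
  obtain ⟨ht1, ht2⟩ := Finset.mem_Icc.1 ht
  have hkt : (splitPoint π₀ p.2 : ℝ) ≤ t := by exact_mod_cast ht1
  refine le_pcEigenvalue_dataMat (T := p.2) hN' (by omega) (by omega) (by omega) hc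
    (η := κ * ((p.2 : ℝ) * (p.1 : ℝ) ^ (b / 2))) (by positivity) (hFω t ht) hLω
    (hAω.trans (le_of_eq ?_)) ?_ hj
  · rw [mul_pow, hκ, Real.sq_sqrt (by positivity), mul_pow, ← Real.rpow_natCast (_ ^ (b / 2)) 2,
      ← Real.rpow_mul hN.le, show b / 2 * ((2 : ℕ) : ℝ) = b by push_cast; ring]
    ring
  · have h1 : (p.1 : ℝ) ^ (b / 2) = (p.1 : ℝ) ^ (-(a - b / 2)) * (p.1 : ℝ) ^ a := by
      rw [← Real.rpow_add hN]
      congr 1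
      ring
    have hNa := Real.rpow_pos_of_pos hN a
    rw [h1]
    calc κ * ((p.2 : ℝ) * ((p.1 : ℝ) ^ (-(a - b / 2)) * (p.1 : ℝ) ^ a))
        = (κ * (p.1 : ℝ) ^ (-(a - b / 2))) * (p.2 * (p.1 : ℝ) ^ a) := by ring
      _ ≤ c * π₀ / 16 * (p.2 * (p.1 : ℝ) ^ a) := by gcongr
      _ = c * (p.1 : ℝ) ^ a / 8 * (π₀ / 2 * p.2) := by ring
      _ ≤ c * (p.1 : ℝ) ^ a / 8 * t := by gcongr; linarith
      _ = _ := by ring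

end Loadings

/-! ### From the well-behaved event to the convergence rates. -/

section Rates

variable {Ω : Type*} {r : ℕ} {f : ℕ → Ω → Fin r → ℝ} {e : ℕ → ℕ → Ω → ℝ}
  {lam : ℕ → ℕ → Ω → Fin r → ℝ} {Fhat : (N t : ℕ) → Ω → Matrix (Fin t) (Fin r) ℝ} {π₀ : ℝ}

theorem inSampleError_eq_inSampleErrorRows (N T : ℕ) (ω : Ω) :
    inSampleError f lam e Fhat π₀ N T ω = inSampleErrorRows f lam e Fhat π₀ N T ω := by
  unfold inSampleError inSampleErrorRows
  refine iSup_congr fun t => ?_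
  rw [frobenius_norm_sq_eq_sum]
  congr 1
  refine Finset.sum_congr rfl fun s _ => ?_
  rw [norm_toLp_sq_eq_sum]
  refine Finset.sum_congr rfl fun j _ => ?_
  simp [Matrix.mul_apply, Matrix.mulVec, dotProduct, factorMat, mul_comm]

theorem inSampleError_nonneg (N T : ℕ) (ω : Ω) : 0 ≤ inSampleError f lam e Fhat π₀ N T ω :=
  Real.iSup_nonneg fun t => by positivity

/-- Summing the row bounds over `s ≤ t` produces at most the full error sum; the factor `t` in the
row bound cancels the averaging, and `t ≥ k₀` makes what remains uniform. -/
theorem inSampleErrorRows_le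
    (hFhat : ∀ N t : ℕ, r ≤ t → ∀ ω, IsPCFactors (dataMat f lam e N t ω) (Fhat N t ω))
    {δ K : ℝ} {N T : ℕ} {ω : Ω} (hδ : 0 < δ) (hN : 0 < N) (hk : 0 < splitPoint π₀ T)
    (hr : r ≤ splitPoint π₀ T) (hK : 0 ≤ K) (h : WellBehaved π₀ f lam e δ K N T ω) :
    inSampleErrorRows f lam e Fhat π₀ N T ω ≤ r * (N * splitPoint π₀ T * δ)⁻¹ ^ 2 * K := by
  have hN' : (0 : ℝ) < N := by exact_mod_cast hN
  have hk' : (0 : ℝ) < splitPoint π₀ T := by exact_mod_cast hk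
  refine Real.iSup_le (fun ⟨t, ht⟩ => ?_) (by positivity)
  obtain ⟨ht1, ht2⟩ := Finset.mem_Icc.1 ht
  have ht0 : 0 < t := hk.trans_le ht1
  have ht0' : (0 : ℝ) < t := by exact_mod_cast ht0
  have hkt : (splitPoint π₀ T : ℝ) ≤ t := by exact_mod_cast ht1
  have hsub : Finset.Icc 1 t ⊆ Finset.Icc 1 T := Finset.Icc_subset_Icc_right (by omega)
  rw [inv_mul_le_iff₀ ht0']
  calc _ ≤ ∑ s : Fin t, r * t * (N * t * δ)⁻¹ ^ 2 *
          ∑ u ∈ Finset.Icc 1 T, errorTerm f lam e N ((s : ℕ) + 1) u ω ^ 2 := by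
        refine Finset.sum_le_sum fun s _ => ?_
        refine (model_row_error_le ht0 (hFhat N t (hr.trans ht1) ω) hδ
          (h.eigenvalue_ge t ht) s).trans ?_
        gcongr
    _ = r * t * (N * t * δ)⁻¹ ^ 2 * ∑ s ∈ Finset.Icc 1 t,
          ∑ u ∈ Finset.Icc 1 T, errorTerm f lam e N s u ω ^ 2 := by
        rw [← Finset.mul_sum, sum_fin_add_one t
          (fun s => ∑ u ∈ Finset.Icc 1 T, errorTerm f lam e N s u ω ^ 2)]
    _ ≤ r * t * (N * t * δ)⁻¹ ^ 2 * errorSum f lam e N T ω := by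
        unfold errorSum
        gcongr
    _ ≤ r * t * (N * splitPoint π₀ T * δ)⁻¹ ^ 2 * K := by
        have h0 : 0 ≤ errorSum f lam e N T ω := by
          unfold errorSum
          positivity
        have hS := h.errorSum_le
        gcongr
    _ = _ := by ring

/-- The estimate changes with `t`, but its last row involves only row `t` of the error matrix.
Extending each row up to `T` and adding over `t` gives at most one full error sum, multiplied by `T`
from the row bound. -/
theorem sum_lastRow_error_le
    (hFhat : ∀ N t : ℕ, r ≤ t → ∀ ω, IsPCFactors (dataMat f lam e N t ω) (Fhat N t ω))
    {δ K : ℝ} {N T a b : ℕ} {ω : Ω} (hδ : 0 < δ) (hN : 0 < N) (hk : 0 < splitPoint π₀ T)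
    (hr : r ≤ splitPoint π₀ T) (ha : splitPoint π₀ T ≤ a) (hb : b ≤ T - 1)
    (h : WellBehaved π₀ f lam e δ K N T ω) :
    ∑ t ∈ Finset.Icc a b,
      ‖WithLp.toLp 2 (lastRow (Fhat N t ω) - modelRotation f lam e Fhat N t ω *ᵥ f t ω)‖ ^ 2 ≤
      T * (r * (N * splitPoint π₀ T * δ)⁻¹ ^ 2 * K) := by
  have hN' : (0 : ℝ) < N := by exact_mod_cast hN
  have hk' : (0 : ℝ) < splitPoint π₀ T := by exact_mod_cast hk
  have hsub : Finset.Icc a b ⊆ Finset.Icc 1 T := Finset.Icc_subset_Icc (by omega) (by omega)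
  calc _ ≤ ∑ t ∈ Finset.Icc a b, r * T * (N * splitPoint π₀ T * δ)⁻¹ ^ 2 *
          ∑ u ∈ Finset.Icc 1 T, errorTerm f lam e N t u ω ^ 2 := by
        refine Finset.sum_le_sum fun t ht => ?_
        obtain ⟨ht1, ht2⟩ := Finset.mem_Icc.1 ht
        have hkt : splitPoint π₀ T ≤ t := ha.trans ht1
        have hkt' : (splitPoint π₀ T : ℝ) ≤ t := by exact_mod_cast hkt
        have ht0 : 0 < t := hk.trans_le hkt
        have htT : t ≤ T := by omega
        have htT' : (t : ℝ) ≤ T := by exact_mod_cast htT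
        have hrow := model_row_error_le ht0 (hFhat N t (hr.trans hkt) ω) hδ
          (h.eigenvalue_ge t (Finset.mem_Icc.2 ⟨hkt, by omega⟩)) ⟨t - 1, by omega⟩
        -- Row `t - 1`, counted from zero, belongs to period `t`.
        simp only [Nat.sub_add_cancel ht0] at hrow
        rw [lastRow, dif_pos ht0]
        refine hrow.trans ?_
        have : Finset.Icc 1 t ⊆ Finset.Icc 1 T := Finset.Icc_subset_Icc_right htT
        gcongr
    _ ≤ r * T * (N * splitPoint π₀ T * δ)⁻¹ ^ 2 * errorSum f lam e N T ω := by
        rw [← Finset.mul_sum]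
        unfold errorSum
        gcongr
    _ ≤ r * T * (N * splitPoint π₀ T * δ)⁻¹ ^ 2 * K := by
        gcongr
        exact h.errorSum_le
    _ = _ := by ring

/-- After `k` is replaced by its lower bound `π₀ T/2`, the two sides are equal. -/
theorem error_bound_le_rate {N T k : ℝ} (hN : 0 < N) (hT : 0 < T) (hπ : 0 < π₀)
    (hk : π₀ / 2 * T ≤ k) {c K a ρ : ℝ} (hc : 0 < c) (hK : 0 ≤ K) (hρ : 0 ≤ ρ) :
    ρ * (N * k * (c * N ^ (a - 1)))⁻¹ ^ 2 * (K * (T ^ 2 * N + N ^ 2 * T)) ≤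
      ρ * K * (2 / (π₀ * c)) ^ 2 * (N ^ (2 - 2 * a) / T + N ^ (1 - 2 * a)) := by
  have hNa := Real.rpow_pos_of_pos hN a
  have e0 : N ^ (2 * a) = (N ^ a) ^ 2 := by
    rw [mul_comm, Real.rpow_mul hN.le]
    norm_num
  have e1 : N ^ (a - 1) = N ^ a / N := Real.rpow_sub_one hN.ne' a
  have e2 : N ^ (2 - 2 * a) = N ^ 2 / (N ^ a) ^ 2 := by
    rw [Real.rpow_sub hN, e0]
    norm_num
  have e3 : N ^ (1 - 2 * a) = N / (N ^ a) ^ 2 := by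
    rw [Real.rpow_sub hN, e0, Real.rpow_one]
  have hk0 : 0 < π₀ / 2 * T := by positivity
  have hk1 : 0 < k := hk0.trans_le hk
  rw [e1, e2, e3]
  calc ρ * (N * k * (c * (N ^ a / N)))⁻¹ ^ 2 * (K * (T ^ 2 * N + N ^ 2 * T))
      ≤ ρ * (N * (π₀ / 2 * T) * (c * (N ^ a / N)))⁻¹ ^ 2 * (K * (T ^ 2 * N + N ^ 2 * T)) := by
        gcongr
    _ = _ := by
        field_simp
        ring

theorem IsOutOfSampleSegment.eventually_length_ge {φ₁ φ₂ : ℕ → ℝ}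
    (h : IsOutOfSampleSegment π₀ φ₁ φ₂) :
    ∃ q : ℝ, 0 < q ∧ ∀ᶠ T : ℕ in atTop, q * T ≤ (⌊φ₂ T⌋₊ : ℝ) - ⌊φ₁ T⌋₊ + 1 := by
  obtain ⟨q₁, q₂, hq, h₁, h₂⟩ := h.shares
  refine ⟨(q₂ - q₁) / 2, by linarith, ?_⟩
  filter_upwards [(h₂.sub h₁).eventually_const_lt (by linarith : (q₂ - q₁) / 2 < q₂ - q₁),
    eventually_gt_atTop 0] with T hT hT0
  have hT' : (0 : ℝ) < T := by exact_mod_cast hT0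
  rw [← sub_div, lt_div_iff₀ hT'] at hT
  linarith

theorem tendsto_rate_iff {l : Filter (ℕ × ℕ)} [l.NeBot] (hl : l ≤ atTop ×ˢ atTop) (a : ℝ) :
    Tendsto (fun p : ℕ × ℕ => (p.1 : ℝ) ^ (2 - 2 * a) / (p.2 : ℝ) + (p.1 : ℝ) ^ (1 - 2 * a))
        l (𝓝 0) ↔
      1 / 2 < a ∧ Tendsto (fun p : ℕ × ℕ => (p.1 : ℝ) ^ (1 - a) / √(p.2 : ℝ)) l (𝓝 0) := by
  have hsq : ∀ p : ℕ × ℕ, (p.1 : ℝ) ^ (2 - 2 * a) / (p.2 : ℝ) =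
      ((p.1 : ℝ) ^ (1 - a) / √(p.2 : ℝ)) ^ 2 := by
    intro p
    rw [div_pow, Real.sq_sqrt (Nat.cast_nonneg _), ← Real.rpow_natCast (_ ^ (1 - a)) 2,
      ← Real.rpow_mul (Nat.cast_nonneg _)]
    congr 2
    push_cast
    ring
  have hN := tendsto_fst_of_le hl
  constructor
  · intro h
    have h1 : Tendsto (fun p : ℕ × ℕ => (p.1 : ℝ) ^ (2 - 2 * a) / (p.2 : ℝ)) l (𝓝 0) :=
      squeeze_zero (fun p => by positivity)
        (fun p => le_add_of_nonneg_right (by positivity)) h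
    have h2 : Tendsto (fun p : ℕ × ℕ => (p.1 : ℝ) ^ (1 - 2 * a)) l (𝓝 0) :=
      squeeze_zero (fun p => by positivity)
        (fun p => le_add_of_nonneg_left (by positivity)) h
    refine ⟨?_, ?_⟩
    -- For `a ≤ 1/2` the term `N^(1-2a)` stays at least `1`; as the filter is nontrivial, some point
    -- contradicts the convergence.
    · by_contra hcon
      have hev := (h2.eventually_lt_const one_pos).and (hN.eventually_ge_atTop 1)
      obtain ⟨p, hp1, hp2⟩ := hev.exists
      exact absurd (Real.one_le_rpow hp2 (by linarith : 0 ≤ 1 - 2 * a)) (not_le.2 hp1)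
    · have h3 := (Real.continuous_sqrt.tendsto 0).comp h1
      rw [Real.sqrt_zero] at h3
      refine h3.congr fun p => ?_
      rw [Function.comp_apply, hsq, Real.sqrt_sq (by positivity)]
  · rintro ⟨ha, h⟩
    have h1 := h.pow 2
    have h2 := (tendsto_rpow_neg_atTop (by linarith : 0 < 2 * a - 1)).comp hN
    have h3 := h1.add h2
    rw [zero_pow two_ne_zero, add_zero] at h3
    refine h3.congr fun p => ?_
    rw [hsq, Function.comp_apply, neg_sub]

variable [MeasurableSpace Ω] {μ : Measure Ω} {l : Filter (ℕ × ℕ)}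

theorem FactorIdioAssumptions.pcRates [IsProbabilityMeasure μ] [l.NeBot]
    (hl : l ≤ atTop ×ˢ atTop) (hπ : π₀ ∈ Set.Ioo (0 : ℝ) 1) (hlam : ∀ N i, Measurable (lam N i))
    (hfe : FactorIdioAssumptions μ l π₀ f e)
    (hFhat : ∀ N t : ℕ, r ≤ t → ∀ ω, IsPCFactors (dataMat f lam e N t ω) (Fhat N t ω))
    {c a b : ℝ} (hc : 0 < c) (hL : LoadingsAtLeast μ l lam c a) (hb : b ≤ 1) (hba : b < 2 * a)
    (hcross : ∃ M : ℝ≥0, ∀ N s t : ℕ, 1 ≤ s → 1 ≤ t →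
      expNonneg μ (fun ω => ((N : ℝ) ^ (-b / 2) * crossTerm f lam e N s t ω) ^ 2) ≤ M) :
    PCRates μ l π₀ f e lam Fhat a := by
  have hgood : ∀ ε : ℝ, 0 < ε → _ := fun ε hε =>
    hfe.wellBehaved hl hπ.1 hlam hc hL hb hba hcross hε
  have hNpos := (tendsto_fst_of_le hl).eventually_gt_atTop 0
  have hTpos := (tendsto_snd_cast_of_le hl).eventually_gt_atTop 0
  have hk := (tendsto_snd_of_le hl).eventually (eventually_le_splitPoint hπ.1)
  have hkr := (tendsto_snd_of_le hl).eventually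
    ((tendsto_splitPoint hπ.1).eventually_ge_atTop (r + 1))
  have hrate : ∀ p : ℕ × ℕ,
      0 ≤ (p.1 : ℝ) ^ (2 - 2 * a) / (p.2 : ℝ) + (p.1 : ℝ) ^ (1 - 2 * a) :=
    fun p => by positivity
  have hIn : IsBigOp μ l (fun p ω => inSampleError f lam e Fhat π₀ p.1 p.2 ω)
      (fun p => (p.1 : ℝ) ^ (2 - 2 * a) / (p.2 : ℝ) + (p.1 : ℝ) ^ (1 - 2 * a)) := by
    intro ε hε
    obtain ⟨K, hK, hW⟩ := hgood ε hε
    -- The summand `1` keeps the constant positive when `r = 0`.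
    refine ⟨r * K * (2 / (π₀ * (c / 4))) ^ 2 + 1, by positivity, ?_⟩
    filter_upwards [hW, hNpos, hTpos, hk, hkr] with p hp hN hT hk hkr
    simp only [← not_le]
    refine measure_not_mono (fun ω hω => ?_) hp
    rw [abs_of_nonneg (inSampleError_nonneg _ _ _), inSampleError_eq_inSampleErrorRows]
    refine (inSampleErrorRows_le hFhat (by positivity) (by exact_mod_cast hN) (by omega)
      (by omega) (by positivity) hω).trans ?_
    refine (error_bound_le_rate hN hT hπ.1 hk (by positivity) hK.le (by positivity)).trans ?_
    exact mul_le_mul_of_nonneg_right (by linarith) (hrate p)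
  have hOut : ∀ φ₁ φ₂ : ℕ → ℝ, IsOutOfSampleSegment π₀ φ₁ φ₂ →
      IsBigOp μ l (fun p ω => outOfSampleError f lam e Fhat φ₁ φ₂ p.1 p.2 ω)
        (fun p => (p.1 : ℝ) ^ (2 - 2 * a) / (p.2 : ℝ) + (p.1 : ℝ) ^ (1 - 2 * a)) := by
    intro φ₁ φ₂ hφ ε hε
    obtain ⟨q, hq, hlen⟩ := hφ.eventually_length_ge
    obtain ⟨K, hK, hW⟩ := hgood ε hε
    refine ⟨q⁻¹ * (r * K * (2 / (π₀ * (c / 4))) ^ 2 + 1), by positivity, ?_⟩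
    filter_upwards [hW, hNpos, hTpos, hk, hkr, (tendsto_snd_of_le hl).eventually hlen,
      (tendsto_snd_of_le hl).eventually hφ.lower, (tendsto_snd_of_le hl).eventually hφ.upper]
      with p hp hN hT hk hkr hlen hlow hup
    simp only [← not_le]
    refine measure_not_mono (fun ω hω => ?_) hp
    have hd : 0 < (⌊φ₂ p.2⌋₊ : ℝ) - ⌊φ₁ p.2⌋₊ + 1 := (mul_pos hq hT).trans_le hlen
    have hδ : 0 < c / 4 * (p.1 : ℝ) ^ (a - 1) := by positivity
    have hsum := sum_lastRow_error_le hFhat hδ (by exact_mod_cast hN) (by omega) (by omega)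
      hlow hup hω
    have hbound := error_bound_le_rate (a := a) hN hT hπ.1 hk (by positivity : 0 < c / 4) hK.le
      (Nat.cast_nonneg r)
    unfold outOfSampleError
    rw [abs_of_nonneg (mul_nonneg (inv_nonneg.2 hd.le) (Finset.sum_nonneg fun _ _ => by positivity)),
      inv_mul_le_iff₀ hd]
    set R := (p.1 : ℝ) ^ (2 - 2 * a) / (p.2 : ℝ) + (p.1 : ℝ) ^ (1 - 2 * a)
    set C := r * K * (2 / (π₀ * (c / 4))) ^ 2
    have hC : 0 ≤ C := by positivity
    have hR : 0 ≤ R := hrate p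
    -- The factor `T` in the bound of the sum is absorbed by the segment length, which is at least
    -- `q T`.
    calc _ ≤ p.2 * (C * R) := hsum.trans (mul_le_mul_of_nonneg_left hbound hT.le)
      _ ≤ p.2 * ((C + 1) * R) := by gcongr; linarith
      _ = q * p.2 * (q⁻¹ * (C + 1) * R) := by field_simp
      _ ≤ _ := mul_le_mul_of_nonneg_right hlen (by positivity)
  refine
    { wellDefined := tendsto_zero_of_le_ofReal fun ε hε => ?_
      outOfSample := hOut
      inSample := hIn.mono_rate ?_
      inSample_rows := inSampleError_eq_inSampleErrorRows
      rate_vanishes_iff := tendsto_rate_iff hl a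
      consistent := fun ha h =>
        have hr := (tendsto_rate_iff hl a).2 ⟨ha, h⟩
        ⟨fun φ₁ φ₂ hφ => (hOut φ₁ φ₂ hφ).tendstoInMeasure hr, hIn.tendstoInMeasure hr⟩ }
  · obtain ⟨K, hK, hW⟩ := hgood ε hε
    filter_upwards [hW, hNpos] with p hp hN
    refine (measure_mono fun ω hω hWω => ?_).trans hp
    obtain ⟨t, ht, hdet⟩ := hω
    refine hdet ?_
    rw [pcD2, Matrix.det_diagonal, isUnit_iff_ne_zero]
    have hδ : 0 < c / 4 * (p.1 : ℝ) ^ (a - 1) := by positivity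
    exact Finset.prod_ne_zero_iff.2 fun j _ =>
      (hδ.trans_le (hWω.eigenvalue_ge t ht j j.2)).ne'
  -- The bound was proved with denominator `T`; as `k₀ ≤ T`, the stated rate with `k₀` is no
  -- smaller.
  · filter_upwards [hkr] with p hkr
    have hk0 : (0 : ℝ) < splitPoint π₀ p.2 := by
      exact_mod_cast (by omega : 0 < splitPoint π₀ p.2)
    have hkT : (splitPoint π₀ p.2 : ℝ) ≤ p.2 := by exact_mod_cast splitPoint_le hπ.2 p.2
    gcongr

end Rates

theorem lemma1 {Ω : Type*} [MeasurableSpace Ω] (μ : Measure Ω) [IsProbabilityMeasure μ]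
    -- `(N, T) → ∞` along `l`: `N` and `T` tend to infinity jointly, along any path
    (l : Filter (ℕ × ℕ)) [l.NeBot] (hl : l ≤ atTop ×ˢ atTop)
    (π₀ : ℝ) (hπ₀ : π₀ ∈ Set.Ioo (0 : ℝ) 1)
    (r : ℕ) (hr : 0 < r)
    (f : ℕ → Ω → Fin r → ℝ) (e : ℕ → ℕ → Ω → ℝ) (lam : ℕ → ℕ → Ω → Fin r → ℝ)
    (hlam : ∀ N i, Measurable (lam N i))
    (hfe : FactorIdioAssumptions μ l π₀ f e)
    -- recursive principal components, re-estimated for every `t`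
    (Fhat : (N t : ℕ) → Ω → Matrix (Fin t) (Fin r) ℝ)
    (hFhat : ∀ N t : ℕ, r ≤ t → ∀ ω, IsPCFactors (dataMat f lam e N t ω) (Fhat N t ω)) :
    -- homogeneous loadings
    (∀ α : ℝ, 0 < α → α ≤ 1 → HomogeneousLoadings μ l f e lam α →
      PCRates μ l π₀ f e lam Fhat α) ∧
    -- heterogeneous loadings
    (∀ α : Fin r → ℝ, Antitone α → α ⟨0, hr⟩ ≤ 1 →
      1 / 2 < α ⟨r - 1, Nat.sub_lt hr one_pos⟩ →
      HeterogeneousLoadings μ l f e lam α (α ⟨r - 1, Nat.sub_lt hr one_pos⟩) →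
      PCRates μ l π₀ f e lam Fhat (α ⟨r - 1, Nat.sub_lt hr one_pos⟩)) := by
  refine ⟨fun α hα0 hα1 h => ?_, fun α hα hα1 hαr h => ?_⟩
  · obtain ⟨c, hc, hL⟩ := h.loadingsAtLeast hl hα0
    -- Here `a = b = α`, so `b < 2a` only requires `α > 0`.
    exact hfe.pcRates hl hπ₀ hlam hFhat hc hL hα1 (by linarith) h.cross
  · obtain ⟨c, hc, hL⟩ := h.loadingsAtLeast hl (by linarith)
      fun j => hα (Fin.mk_le_mk.2 (Nat.le_sub_one_of_lt j.2))
    -- Here `b = 1`, and `b < 2a` is the condition `α_r > 1/2`.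
    exact hfe.pcRates hl hπ₀ hlam hFhat hc hL le_rfl (by linarith) h.crossTerm_bound
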